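/- Let $F$ be a free group of finite rank. A straight word in $F$ is an element of $F$, a cyclic word in $F$ is a conjugacy class of elements of $F$, and a word is a straight or cyclic word. For an $F$-basis (free generating set) $X$, put $X^{\pm1}=X\cup X^{-1}$; the $X$-length of a straight word $r$ is the length of the reduced $X^{\pm1}$-sequence with product $r$, and the $X$-length of a cyclic word $r$ is the length of any cyclically reduced $X^{\pm1}$-sequence with product in $r$. For a finite set $R$ of words in $F$ let $h(X)=\sum_{r\in R}X\text{-length}(r)$. An $F$-basis $Y$ is a Whitehead transform of $X$ if $Y\subseteq\{1,x\}\cdot X\cdot\{1,x^{-1}\}$ for some $x\in X^{\pm1}$, and $Y$ is an $F$-neighbour of $X$ if $Y^{\pm1}=X^{\pm1}$ or $Y$ is a Whitehead transform of $X$. A basis $X$ is a local minimum of $h$ if $h(X)\le h(X')$ for each Whitehead transform $X'$ of $X$, and it is $h$-minimal if $h(X)\le h(Z)$ for every $F$-basis $Z$. Let $\Gamma(F)$ be the (undirected) graph whose vertices are the $F$-bases and whose edges join $F$-neighbours, and let $\Gamma(h)$ be the full subgraph of $\Gamma(F)$ whose vertices are the local minima of $h$. For every finite set $R$ of words in $F$: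 (a) $\Gamma(h)$ is connected. (b) $h$ is constant on each connected subgraph of $\Gamma(h)$. (c) From every $F$-basis there is a path in $\Gamma(F)$ to a vertex of $\Gamma(h)$ along which each basis after the first is a Whitehead transform of the preceding one and $h$ strictly decreases. (d) Every $h$-minimal basis $Y$ is a vertex of $\Gamma(h)$, and for every local minimum $X$ of $h$ (in particular for every $h$-minimal basis $X$) there is a path in $\Gamma(h)$ from $Y$ to $X$ along which $h$ is constant. Moreover: (e) $\Gamma(F)$ is connected (Nielsen). (f) (Whitehead's second algorithm.) For each finite, indexed basis of $F$ there is an algorithm (a computable function) which, with input two finite sequences $S_1,S_2$ of words in $F$, each term being labelled as straight or cyclic and given by a finite sequence of basis elements and their inverses, outputs either the images of the basis elements under some automorphism $\phi$ of $F$ with $\phi(S_1)=S_2$ (term by term), or an assurance that no such $\phi$ exists. -/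

import Mathlib

open scoped Pointwise

/-- A subset `X` of a group `F` is an `F`-basis (a free-generating set) if the natural
morphism from the free group on `X` to `F` is bijective. -/
def IsFBasis {F : Type*} [Group F] (X : Set F) : Prop :=
  Function.Bijective (FreeGroup.lift (Subtype.val : X → F))

/-- The type of `F`-bases. -/
abbrev FBasis (F : Type*) [Group F] : Type _ := {X : Set F // IsFBasis X}

/-- A word in `F` is either a straight word (an element of `F`) or a cyclic word
(a conjugacy class of elements of `F`). -/
abbrev FWord (F : Type*) [Group F] : Type _ := F ⊕ ConjClasses F

/-- The image of a word under an automorphism. -/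
def FWord.map {F : Type*} [Group F] (φ : F ≃* F) : FWord F → FWord F :=
  Sum.map φ (ConjClasses.map φ.toMonoidHom)

namespace FBasis

variable {F : Type*} [Group F]

/-- The isomorphism from the free group on the set `X` to `F`. -/
noncomputable def equiv (X : FBasis F) : FreeGroup X.1 ≃* F :=
  MulEquiv.ofBijective (FreeGroup.lift (Subtype.val : X.1 → F)) X.2

open Classical in
/-- The unique reduced `X^{±1}`-sequence with product `g`
(the letters `(x, true)` and `(x, false)` stand for `x` and `x⁻¹`). -/
noncomputable def reducedSeq (X : FBasis F) (g : F) : List (X.1 × Bool) :=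
  (X.equiv.symm g).toWord

open Classical in
/-- A cyclically reduced `X^{±1}`-sequence whose product lies in the conjugacy class `c`;
it is unique up to cyclic permutation. -/
noncomputable def cyclicallyReducedSeq (X : FBasis F) (c : ConjClasses F) : List (X.1 × Bool) :=
  FreeGroup.reduceCyclically (X.reducedSeq (Quotient.out c))

/-- The `X`-length of a straight or cyclic word. -/
noncomputable def wordLength (X : FBasis F) : FWord F → ℕ
  | Sum.inl g => (X.reducedSeq g).length
  | Sum.inr c => (X.cyclicallyReducedSeq c).length

/-- `h(X)`: the total `X`-length of the words in the finite set `R`. -/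
noncomputable def height (R : Finset (FWord F)) (X : FBasis F) : ℕ :=
  ∑ r ∈ R, X.wordLength r

/-- `X^{±1} = X ∪ X⁻¹`. -/
def signed (X : FBasis F) : Set F := X.1 ∪ (X.1)⁻¹

/-- `Y` is a Whitehead transform of `X`: there is some `x ∈ X^{±1}` such that
`Y ⊆ {1, x} · X · {1, x⁻¹}`. -/
def IsWhiteheadTransform (X Y : FBasis F) : Prop :=
  ∃ x ∈ X.signed, Y.1 ⊆ ({1, x} : Set F) * X.1 * ({1, x⁻¹} : Set F)

/-- `Y` is an `F`-neighbour of `X`. -/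
def IsNeighbour (X Y : FBasis F) : Prop :=
  Y.signed = X.signed ∨ IsWhiteheadTransform X Y

/-- `X` is a local-minimum point for `h`. -/
def IsLocalMin (R : Finset (FWord F)) (X : FBasis F) : Prop :=
  ∀ X' : FBasis F, IsWhiteheadTransform X X' → height R X ≤ height R X'

/-- `X` is `h`-minimal among all `F`-bases. -/
def IsGlobalMin (R : Finset (FWord F)) (X : FBasis F) : Prop :=
  ∀ Z : FBasis F, height R X ≤ height R Z

end FBasis

/-- The graph `Γ(F)`: its vertices are the `F`-bases, and its edges join (distinct)
`F`-neighbours. -/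
def GammaF (F : Type*) [Group F] : SimpleGraph (FBasis F) :=
  SimpleGraph.fromRel FBasis.IsNeighbour

/-- The graph `Γ(h)`: the full subgraph of `Γ(F)` on the local-minimum points for `h`. -/
def GammaH {F : Type*} [Group F] (R : Finset (FWord F)) :
    SimpleGraph {X : FBasis F // FBasis.IsLocalMin R X} :=
  (GammaF F).induce {X : FBasis F | FBasis.IsLocalMin R X}

/-- Finite data describing a word in a free group with a basis indexed by `Fin n`:
a straight word or a cyclic word, given by a (not necessarily reduced) sequence of basis
elements (marked `true`) and inverses of basis elements (marked `false`). -/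
abbrev WordCode (n : ℕ) : Type := List (Fin n × Bool) ⊕ List (Fin n × Bool)

/-- The element of `F` spelled by a sequence of letters. -/
def spell {F : Type*} [Group F] {n : ℕ} (b : FreeGroupBasis (Fin n) F)
    (l : List (Fin n × Bool)) : F :=
  b.repr.symm (FreeGroup.mk l)

/-- The word in `F` described by a code. -/
def WordCode.decode {F : Type*} [Group F] {n : ℕ} (b : FreeGroupBasis (Fin n) F) :
    WordCode n → FWord F :=
  Sum.map (spell b) (fun l => ConjClasses.mk (spell b l))

/-- The `F`-automorphism `φ` carries the coded sequence `S₁` to the coded sequence `S₂`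
term by term. -/
def CarriesSeq {F : Type*} [Group F] {n : ℕ} (b : FreeGroupBasis (Fin n) F) (φ : F ≃* F)
    (S₁ S₂ : List (WordCode n)) : Prop :=
  S₁.map (fun r => FWord.map φ (WordCode.decode b r)) = S₂.map (WordCode.decode b)

/-- `f` solves the automorphism problem for finite sequences of words: on input `S₁, S₂`, it
either outputs the images of the basis elements under some `F`-automorphism carrying `S₁`
to `S₂`, or outputs `none`, in which case no such automorphism exists. -/
def SolvesAutomorphismProblem {F : Type*} [Group F] {n : ℕ} (b : FreeGroupBasis (Fin n) F)
    (f : List (WordCode n) × List (WordCode n) → Option (Fin n → List (Fin n × Bool))) : Prop :=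
  ∀ S₁ S₂ : List (WordCode n),
    (∀ w, f (S₁, S₂) = some w →
      ∃ φ : F ≃* F, (∀ i, φ (b i) = spell b (w i)) ∧ CarriesSeq b φ S₁ S₂) ∧
    (f (S₁, S₂) = none → ¬ ∃ φ : F ≃* F, CarriesSeq b φ S₁ S₂)

/-! The proof is geometric. A basis `X` turns `F` into a tree with edges from `g` to `g * x`. The
half-spaces of this tree are almost invariant subsets of `F`, and up to left translation and
complement there is one for each element of `X`. The `X`-length of `r` counts, over these
half-spaces, the translates of the pair `(1, r)` that they separate. So `h(X)` is a sum over `X` of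
values `cap A` of one functional on subsets of `F` that does not depend on `X` (`cutSum_height`).
Cyclic words are included by averaging the counts for `(1, r ^ k)` along an ultrafilter.

A Whitehead transform can replace one half-space by a suitable union of branches at a vertex and
keep all other summands (`exists_transform`). Comparing bases thus becomes an exchange of cuts. Let
`X` be a local minimum and `Y` any basis. If some half-spaces cross, choose the crossing that
minimizes `disc`, the weight of the pairs inside one half-space that the other separates. By
`cap_inter_add_disc_le`, either an innermost half-space of `Y` can be cut down to a corner without
raising `h`, or one of `X` can be cut down with strict gain, which local minimality forbids. If
nothing crosses, a computation in the abelianization yields a symmetric exchange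
(`exists_exchange`), and local minimality of `X` again bounds the cost for `Y`. Either way the total
crossing number with `X` drops (`exists_transform_le`), until the bases agree up to inversion. Hence
local minima are global and are joined at constant height; the case of no words is Nielsen's
theorem.

For the algorithm, bases of height at most `N` are connected through such bases
(`reachable_induce_height`). Equivalent sequences of words are therefore joined by automorphisms
from a fixed finite set with all intermediate words of bounded length, and a search with an explicit
number of steps suffices. -/

namespace FBasis

/-! ### Crossing of subsets -/

section Cross

variable {α : Type*} {A B : Set α}

/-- Two sets cross if all four corners are nonempty. -/
def Cross (A B : Set α) : Prop :=
  (A ∩ B).Nonempty ∧ (A ∩ Bᶜ).Nonempty ∧ (Aᶜ ∩ B).Nonempty ∧ (Aᶜ ∩ Bᶜ).Nonempty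

theorem Cross.symm (h : Cross A B) : Cross B A := by
  obtain ⟨h1, h2, h3, h4⟩ := h
  exact ⟨by rwa [Set.inter_comm], by rwa [Set.inter_comm], by rwa [Set.inter_comm],
    by rwa [Set.inter_comm]⟩

theorem cross_compl_left : Cross Aᶜ B ↔ Cross A B := by
  simp only [Cross, compl_compl]; tauto

theorem cross_compl_right : Cross A Bᶜ ↔ Cross A B := by
  simp only [Cross, compl_compl]; tauto

end Cross

variable {F : Type*} [Group F]

/-! ### Letters of a basis and homomorphisms out of a based free group -/

@[simp] theorem equiv_of (X : FBasis F) (x : X.1) : X.equiv (FreeGroup.of x) = x :=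
  FreeGroup.lift_apply_of

@[simp] theorem equiv_symm_coe (X : FBasis F) (x : X.1) :
    X.equiv.symm (x : F) = FreeGroup.of x := by
  rw [MulEquiv.symm_apply_eq, equiv_of]

/-- The homomorphism with prescribed values on a basis. -/
noncomputable def lift (X : FBasis F) {G : Type*} [Group G] (f : X.1 → G) : F →* G :=
  (FreeGroup.lift f).comp X.equiv.symm.toMonoidHom

@[simp] theorem lift_coe (X : FBasis F) {G : Type*} [Group G] (f : X.1 → G) (x : X.1) :
    X.lift f x = f x := by
  simp [lift]

theorem hom_ext (X : FBasis F) {G : Type*} [Monoid G] {f g : F →* G}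
    (h : ∀ x ∈ X.1, f x = g x) : f = g := by
  have : f.comp X.equiv.toMonoidHom = g.comp X.equiv.toMonoidHom := by
    ext x
    simpa using h x x.2
  ext a
  have := DFunLike.congr_fun this (X.equiv.symm a)
  simpa using this

theorem closure_eq_top (X : FBasis F) : Subgroup.closure X.1 = ⊤ := by
  rw [eq_top_iff]
  rintro g -
  obtain ⟨w, rfl⟩ := X.equiv.surjective g
  have : (FreeGroup.lift (Subtype.val : X.1 → F)).range ≤ Subgroup.closure X.1 :=
    FreeGroup.range_lift_le (by simp)
  exact this ⟨w, rfl⟩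

/-- The element of the group represented by a letter. -/
def letter (X : FBasis F) (l : X.1 × Bool) : F := if l.2 then l.1 else (l.1 : F)⁻¹

theorem equiv_symm_letter (X : FBasis F) (l : X.1 × Bool) :
    X.equiv.symm (X.letter l) = FreeGroup.mk [l] := by
  obtain ⟨x, _ | _⟩ := l
  · simp only [letter, Bool.false_eq_true, if_false, map_inv, equiv_symm_coe]
    rfl
  · simp only [letter, if_true, equiv_symm_coe]
    rfl

theorem letter_injective (X : FBasis F) : Function.Injective X.letter := by
  classical
  intro l l' h
  have := congrArg (fun g => (X.equiv.symm g).toWord) h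
  simpa [equiv_symm_letter, FreeGroup.toWord_mk] using this

theorem letter_not (X : FBasis F) (x : X.1) (s : Bool) :
    X.letter (x, !s) = (X.letter (x, s))⁻¹ := by
  cases s <;> simp [letter]

theorem mem_signed_iff (X : FBasis F) {a : F} : a ∈ X.signed ↔ ∃ l, X.letter l = a := by
  constructor
  · rintro (h | h)
    · exact ⟨(⟨a, h⟩, true), by simp [letter]⟩
    · exact ⟨(⟨a⁻¹, h⟩, false), by simp [letter]⟩
  · rintro ⟨⟨x, _ | _⟩, rfl⟩
    · right; simp [letter]
    · left; simp [letter]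

theorem letter_mem_signed (X : FBasis F) (l : X.1 × Bool) : X.letter l ∈ X.signed :=
  X.mem_signed_iff.2 ⟨l, rfl⟩

theorem mem_signed_of_mem (X : FBasis F) {a : F} (h : a ∈ X.1) : a ∈ X.signed := Or.inl h

theorem inv_mem_signed (X : FBasis F) {a : F} (h : a ∈ X.signed) : a⁻¹ ∈ X.signed := by
  rcases h with h | h
  · right; simpa using h
  · left; simpa using h

theorem ne_inv_of_mem_signed (X : FBasis F) {a : F} (h : a ∈ X.signed) : a ≠ a⁻¹ := by
  obtain ⟨⟨x, s⟩, rfl⟩ := X.mem_signed_iff.1 h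
  rw [← letter_not]
  intro h
  have := X.letter_injective h
  simp at this

theorem inv_notMem (X : FBasis F) {a : F} (h : a ∈ X.1) : a⁻¹ ∉ X.1 := by
  intro h'
  have : X.letter (⟨a, h⟩, false) = X.letter (⟨a⁻¹, h'⟩, true) := by simp [letter]
  have := X.letter_injective this
  simp at this

theorem ne_one_of_mem_signed (X : FBasis F) {a : F} (h : a ∈ X.signed) : a ≠ 1 := by
  rintro rfl
  exact X.ne_inv_of_mem_signed h (by simp)

/-- Two letters which agree up to inversion and both lie in the basis agree. -/
theorem eq_of_mem_of_eq_inv (X : FBasis F) {a b : F} (ha : a ∈ X.1) (hb : b ∈ X.1)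
    (h : a = b ∨ a = b⁻¹) : a = b := by
  rcases h with h | rfl
  · exact h
  · exact absurd ha (X.inv_notMem hb)

/-! ### Half-spaces of the Cayley tree -/

/-- `A` is the half-space of the Cayley tree of `X` whose only ingoing edge goes
from `v` to `v * a`. -/
def IsHalf (X : FBasis F) (A : Set F) (v a : F) : Prop :=
  a ∈ X.signed ∧ ∀ g, ∀ x ∈ X.signed, (g ∉ A ∧ g * x ∈ A) ↔ (g = v ∧ x = a)

/-- The set of half-spaces of the Cayley tree of `X`. -/
def halves (X : FBasis F) : Set (Set F) := {A | ∃ v a, X.IsHalf A v a}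

theorem IsHalf.mem_halves {X : FBasis F} {A : Set F} {v a : F} (h : X.IsHalf A v a) :
    A ∈ X.halves := ⟨v, a, h⟩

/-- Half of the Cayley tree: the elements whose reduced sequence begins with `l`. -/
def half (X : FBasis F) (l : X.1 × Bool) : Set F := {g | (X.reducedSeq g).head? = some l}

open Classical in
theorem reducedSeq_inv (X : FBasis F) (g : F) :
    X.reducedSeq g⁻¹ = FreeGroup.invRev (X.reducedSeq g) := by
  simp [reducedSeq, FreeGroup.toWord_inv]

theorem reducedSeq_one (X : FBasis F) : X.reducedSeq 1 = [] := by
  simp [reducedSeq]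

theorem reducedSeq_eq_nil (X : FBasis F) {g : F} : X.reducedSeq g = [] ↔ g = 1 := by
  simp [reducedSeq]

/-- Multiplying on the left by a letter either prepends it or cancels the first letter. -/
theorem reducedSeq_letter_mul (X : FBasis F) (x : X.1) (s : Bool) (g : F) :
    (X.reducedSeq (X.letter (x, s) * g) = (x, s) :: X.reducedSeq g ∧
      (X.reducedSeq g).head? ≠ some (x, !s)) ∨
    X.reducedSeq g = (x, !s) :: X.reducedSeq (X.letter (x, s) * g) := by
  classical
  have h1 : X.reducedSeq (X.letter (x, s) * g) = FreeGroup.reduce ((x, s) :: X.reducedSeq g) := by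
    simp only [reducedSeq, map_mul, equiv_symm_letter, FreeGroup.toWord_mul, FreeGroup.toWord_mk,
      FreeGroup.reduce_singleton, List.singleton_append]
  have h2 : FreeGroup.reduce (X.reducedSeq g) = X.reducedSeq g := FreeGroup.reduce_toWord _
  rw [h1, FreeGroup.reduce.cons, h2]
  rcases X.reducedSeq g with _ | ⟨⟨y, t⟩, w⟩
  · left; simp
  · by_cases h : x = y ∧ s = !t
    · right
      obtain ⟨rfl, rfl⟩ := h
      simp
    · left
      simp only [if_neg h, List.head?_cons, ne_eq, Option.some.injEq, Prod.mk.injEq, true_and]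
      rintro ⟨rfl, rfl⟩
      simp at h

/-- Multiplying on the right by a letter either appends it or cancels the last letter. -/
theorem reducedSeq_mul_letter (X : FBasis F) (x : X.1) (s : Bool) (g : F) :
    X.reducedSeq (g * X.letter (x, s)) = X.reducedSeq g ++ [(x, s)] ∨
    X.reducedSeq g = X.reducedSeq (g * X.letter (x, s)) ++ [(x, !s)] := by
  have h := X.reducedSeq_letter_mul x (!s) g⁻¹
  have e : X.letter (x, !s) * g⁻¹ = (g * X.letter (x, s))⁻¹ := by rw [letter_not, mul_inv_rev]
  rw [e, reducedSeq_inv, reducedSeq_inv] at h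
  rcases h with ⟨h, -⟩ | h
  · left
    have := congrArg FreeGroup.invRev h
    rw [FreeGroup.invRev_invRev] at this
    rw [this]
    simp [FreeGroup.invRev, Function.comp_def]
  · right
    have := congrArg FreeGroup.invRev h
    rw [FreeGroup.invRev_invRev] at this
    rw [this]
    simp [FreeGroup.invRev, Function.comp_def]

theorem isHalf_half (X : FBasis F) (l : X.1 × Bool) : X.IsHalf (X.half l) 1 (X.letter l) := by
  refine ⟨X.letter_mem_signed l, fun g x hx => ?_⟩
  obtain ⟨⟨x, s⟩, rfl⟩ := X.mem_signed_iff.1 hx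
  constructor
  · rintro ⟨h1, h2⟩
    simp only [half, Set.mem_ofPred_eq] at h1 h2
    rcases X.reducedSeq_mul_letter x s g with h | h
    · rw [h] at h2
      by_cases hg : X.reducedSeq g = []
      · rw [hg] at h2
        exact ⟨X.reducedSeq_eq_nil.1 hg, by simpa using congrArg (Option.map X.letter) h2⟩
      · rw [List.head?_append_of_ne_nil _ hg] at h2
        exact absurd h2 h1
    · rw [h] at h1
      rw [List.head?_append, h2] at h1
      simp at h1
  · rintro ⟨rfl, h⟩
    have := X.letter_injective h
    subst this
    refine ⟨by simp [half, reducedSeq_one], ?_⟩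
    rcases X.reducedSeq_mul_letter x s 1 with h | h
    · simp only [half, Set.mem_ofPred_eq, h, reducedSeq_one]
      simp
    · rw [reducedSeq_one] at h
      simp at h

variable {X : FBasis F} {A B : Set F} {u v w a b c g : F}

theorem IsHalf.smul (h : X.IsHalf A v a) (f : F) : X.IsHalf (f • A) (f * v) a := by
  refine ⟨h.1, fun g x hx => ?_⟩
  have := h.2 (f⁻¹ * g) x hx
  rw [Set.mem_smul_set_iff_inv_smul_mem, Set.mem_smul_set_iff_inv_smul_mem, smul_eq_mul,
    smul_eq_mul, ← mul_assoc, this, inv_mul_eq_iff_eq_mul]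

theorem IsHalf.notMem (h : X.IsHalf A v a) : v ∉ A := ((h.2 v a h.1).2 ⟨rfl, rfl⟩).1

theorem IsHalf.mem (h : X.IsHalf A v a) : v * a ∈ A := ((h.2 v a h.1).2 ⟨rfl, rfl⟩).2

theorem IsHalf.enter (h : X.IsHalf A v a) {x : F} (hx : x ∈ X.signed) (h1 : g ∉ A)
    (h2 : g * x ∈ A) : g = v ∧ x = a := (h.2 g x hx).1 ⟨h1, h2⟩

theorem IsHalf.leave (h : X.IsHalf A v a) {x : F} (hx : x ∈ X.signed) (h1 : g ∈ A)
    (h2 : g * x ∉ A) : g * x = v ∧ x = a⁻¹ := by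
  have := h.enter (X.inv_mem_signed hx) h2 (by simpa using h1)
  exact ⟨this.1, by rw [← this.2, inv_inv]⟩

theorem IsHalf.compl (h : X.IsHalf A v a) : X.IsHalf Aᶜ (v * a) a⁻¹ := by
  refine ⟨X.inv_mem_signed h.1, fun g x hx => ⟨?_, ?_⟩⟩
  · rintro ⟨h1, h2⟩
    obtain ⟨h3, rfl⟩ := h.leave hx (not_not.1 h1) h2
    exact ⟨by rw [← h3]; group, rfl⟩
  · rintro ⟨rfl, rfl⟩
    simp [h.mem, h.notMem]

/-- A set without ingoing edges is trivial. -/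
theorem eq_univ_of_no_enter (X : FBasis F) {S : Set F}
    (h : ∀ g, ∀ x ∈ X.signed, g * x ∈ S → g ∈ S) (hS : S.Nonempty) : S = Set.univ := by
  obtain ⟨s, hs⟩ := hS
  have key : ∀ k ∈ Subgroup.closure X.1, ∀ g, g ∈ S ↔ g * k ∈ S := by
    intro k hk
    induction hk using Subgroup.closure_induction with
    | mem x hx =>
      intro g
      exact ⟨fun hg => h _ x⁻¹ (X.inv_mem_signed (X.mem_signed_of_mem hx)) (by simpa using hg),
        h _ x (X.mem_signed_of_mem hx)⟩
    | one => simp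
    | mul x y _ _ hx hy => intro g; rw [hx g, hy, mul_assoc]
    | inv x _ hx => intro g; rw [hx (g * x⁻¹)]; simp
  refine Set.eq_univ_of_forall fun g => ?_
  rw [key (g⁻¹ * s) (by rw [X.closure_eq_top]; trivial) g]
  simpa using hs

theorem eq_empty_of_no_enter (X : FBasis F) {S : Set F}
    (h : ∀ g, ∀ x ∈ X.signed, g * x ∈ S → g ∈ S) (hg : g ∉ S) : S = ∅ := by
  by_contra hne
  rw [X.eq_univ_of_no_enter h (Set.nonempty_iff_ne_empty.2 hne)] at hg
  exact hg trivial

/-- A half-space is connected: a subset, all of whose ingoing edges are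
ingoing edges of the half-space, is trivial. -/
theorem IsHalf.subset_of_enter (h : X.IsHalf A v a) {S : Set F} (hSA : S ⊆ A)
    (hS : ∀ g ∈ A, ∀ x ∈ X.signed, (g * x ∈ S → g ∈ S)) (hne : S.Nonempty) : A ⊆ S := by
  -- According to whether the root `v * a` lies in `S`, it is `A \ S` or `S` that has no ingoing
  -- edge at all.
  by_cases hw : v * a ∈ S
  · have : A \ S = ∅ := by
      refine X.eq_empty_of_no_enter (g := v) ?_ (by simp [h.notMem])
      rintro g x hx ⟨h1, h2⟩
      by_cases hg : g ∈ A
      · exact ⟨hg, fun hgS => h2 (hS _ h1 x⁻¹ (X.inv_mem_signed hx) (by simpa using hgS))⟩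
      · obtain ⟨rfl, rfl⟩ := h.enter hx hg h1
        exact absurd hw h2
    exact Set.sdiff_eq_empty.1 this
  · exfalso
    have : S = ∅ := by
      refine X.eq_empty_of_no_enter (g := v * a) ?_ hw
      intro g x hx h1
      by_cases hg : g ∈ A
      · exact hS g hg x hx h1
      · obtain ⟨rfl, rfl⟩ := h.enter hx hg (hSA h1)
        exact absurd h1 hw
    exact hne.ne_empty this

theorem IsHalf.subset_of_isHalf (h : X.IsHalf A v a) (h' : X.IsHalf B v a) : A ⊆ B := by
  refine (h.subset_of_enter (S := A ∩ B) Set.inter_subset_left ?_ ⟨_, h.mem, h'.mem⟩).trans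
    Set.inter_subset_right
  rintro g hg x hx ⟨h1, h2⟩
  refine ⟨hg, by_contra fun hgB => ?_⟩
  obtain ⟨rfl, rfl⟩ := h'.enter hx hgB h2
  exact h.notMem hg

theorem IsHalf.unique (h : X.IsHalf A v a) (h' : X.IsHalf B v a) : A = B :=
  (h.subset_of_isHalf h').antisymm (h'.subset_of_isHalf h)

theorem exists_isHalf (X : FBasis F) (v : F) (ha : a ∈ X.signed) : ∃ A, X.IsHalf A v a := by
  obtain ⟨l, rfl⟩ := X.mem_signed_iff.1 ha
  exact ⟨_, by simpa using (X.isHalf_half l).smul v⟩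

/-- The half-spaces at a vertex cover all other vertices. -/
theorem exists_isHalf_mem (X : FBasis F) (h : g ≠ v) : ∃ A a, X.IsHalf A v a ∧ g ∈ A := by
  have hne : X.reducedSeq (v⁻¹ * g) ≠ [] := by
    rw [Ne, reducedSeq_eq_nil, inv_mul_eq_one]
    exact h.symm
  obtain ⟨l, t, hl⟩ := List.exists_cons_of_ne_nil hne
  refine ⟨_, _, by simpa using (X.isHalf_half l).smul v, ?_⟩
  rw [Set.mem_smul_set_iff_inv_smul_mem]
  simp [half, hl]

theorem smul_mem_halves (h : A ∈ X.halves) (f : F) : f • A ∈ X.halves := by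
  obtain ⟨v, a, h⟩ := h
  exact ⟨_, _, h.smul f⟩

theorem compl_mem_halves (h : A ∈ X.halves) : Aᶜ ∈ X.halves := by
  obtain ⟨v, a, h⟩ := h
  exact ⟨_, _, h.compl⟩

theorem cross_smul_iff (f : F) : Cross (f • A) (f • B) ↔ Cross A B := by
  simp only [Cross, ← Set.smul_set_compl, ← Set.smul_set_inter, Set.smul_set_nonempty]

theorem cross_smul_left (f : F) : Cross (f • A) B ↔ Cross A (f⁻¹ • B) := by
  rw [← cross_smul_iff f⁻¹, inv_smul_smul]

/-- If both ends of the edge of `B` lie on one side of `A`, the other side is connected and avoids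
that edge, so it lies on one side of `B`. If the edge joins the two sides, it is the edge of `A`,
and `B` is `A` or `Aᶜ`. -/
theorem not_cross_of_halves (hA : A ∈ X.halves) (hB : B ∈ X.halves) : ¬ Cross A B := by
  rintro ⟨h1, h2, h3, h4⟩
  obtain ⟨v, a, hA⟩ := hA
  obtain ⟨u, b, hB⟩ := hB
  by_cases hu : u ∈ A
  · -- no edge of `B` has its source outside `A`
    by_cases hub : u * b ∈ A
    · have := hA.compl.subset_of_enter (S := Aᶜ ∩ B) Set.inter_subset_left ?_ h3
      · obtain ⟨p, hp, hp'⟩ := h4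
        exact hp' (this hp).2
      · rintro g hg x hx ⟨h5, h6⟩
        refine ⟨hg, by_contra fun hgB => ?_⟩
        obtain ⟨rfl, rfl⟩ := hB.enter hx hgB h6
        exact hg hu
    · have e := hA.leave hB.1 hu hub
      have : B = Aᶜ := hB.unique (by simpa [← e.1, e.2] using hA.compl)
      rw [this] at h1
      simp at h1
  · by_cases hub : u * b ∈ A
    · have e := hA.enter hB.1 hu hub
      have : B = A := hB.unique (by simpa [e.1, e.2] using hA)
      rw [this] at h2
      simp at h2
    · have := hA.subset_of_enter (S := A ∩ B) Set.inter_subset_left ?_ h1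
      · obtain ⟨p, hp, hp'⟩ := h2
        exact hp' (this hp).2
      · rintro g hg x hx ⟨h5, h6⟩
        refine ⟨hg, by_contra fun hgB => ?_⟩
        obtain ⟨rfl, rfl⟩ := hB.enter hx hgB h6
        exact hu hg

/-- Two half-spaces for the same letter are translates of each other. -/
theorem IsHalf.eq_smul (h : X.IsHalf A v a) (h' : X.IsHalf B u a) : A = (v * u⁻¹) • B :=
  h.unique (by simpa using h'.smul (v * u⁻¹))

/-- A half-space is a translate of the standard half-space of its letter, up to complement. -/
theorem IsHalf.apply_eq {M : Type*} {φ : Set F → M} (hs : ∀ (f : F) A, φ (f • A) = φ A)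
    (hc : ∀ A, φ Aᶜ = φ A) (h : X.IsHalf A v a) (h' : X.IsHalf B u b) (hab : a = b ∨ a = b⁻¹) :
    φ A = φ B := by
  rcases hab with rfl | rfl
  · rw [h.eq_smul h', hs]
  · rw [h.eq_smul h'.compl, hs, hc]

end FBasis

namespace FBasis

variable {F : Type*} [Group F]

/-! ### Finiteness of bases and sums over the half-spaces of a basis -/

-- The homomorphisms to `ZMod 2` dual to the elements of `X` are distinct, and each is determined by
-- its values on a finite generating set.
open Classical in
instance finite [Group.FG F] (X : FBasis F) : Finite X.1 := by
  obtain ⟨S, hS⟩ := Group.FG.out (G := F)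
  let a : Multiplicative (ZMod 2) := Multiplicative.ofAdd 1
  have ha : a ≠ 1 := by decide
  let f : X.1 → (S → Multiplicative (ZMod 2)) := fun x s => X.lift (Pi.mulSingle x a) (s : F)
  refine Finite.of_injective f fun x y hxy => ?_
  have h : X.lift (Pi.mulSingle x a) = X.lift (Pi.mulSingle y a) :=
    MonoidHom.eq_of_eqOn_dense hS fun s hs => congrFun hxy ⟨s, hs⟩
  by_contra hne
  have := DFunLike.congr_fun h (x : F)
  rw [lift_coe, lift_coe, Pi.mulSingle_eq_same, Pi.mulSingle_eq_of_ne hne] at this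
  exact ha this

theorem finite_signed [Group.FG F] (X : FBasis F) : X.signed.Finite :=
  (Set.toFinite X.1).union (Set.toFinite X.1).inv

/-- The sum of the values of a function at the half-spaces of a basis, one for each element. -/
noncomputable def cutSum {M : Type*} [AddCommMonoid M] (X : FBasis F) (φ : Set F → M) : M :=
  ∑ᶠ a : X.1, φ (X.half (a, true))

theorem isHalf_half_true (X : FBasis F) (x : X.1) : X.IsHalf (X.half (x, true)) 1 x := by
  simpa [letter] using X.isHalf_half (x, true)

/-! ### The length formula -/

/-- Each edge of the path from `1` to `r` contributes one separated position. Removing the first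
letter translates the sets of separated positions on the right and deletes one position, for the
half-space of that letter only. -/
theorem cutSum_encard [Group.FG F] (X : FBasis F) (r : F) :
    X.cutSum (fun A => {g | ¬ (g ∈ A ↔ g * r ∈ A)}.encard) = (X.reducedSeq r).length := by
  classical
  have : Fintype X.1 := Fintype.ofFinite _
  rw [cutSum, finsum_eq_sum_of_fintype]
  generalize hw : X.reducedSeq r = L
  induction L generalizing r with
  | nil =>
    rw [reducedSeq_eq_nil] at hw
    subst hw
    simp
  | cons l L ih =>
    obtain ⟨x, s⟩ := l
    obtain ⟨r', rfl⟩ : ∃ r', r = X.letter (x, s) * r' := ⟨X.letter (x, !s) * r, by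
      rw [letter_not]; simp⟩
    have hr' : X.reducedSeq r' = L ∧ (X.reducedSeq r').head? ≠ some (x, !s) := by
      rcases X.reducedSeq_letter_mul x s r' with ⟨h, h'⟩ | h
      · rw [hw] at h
        exact ⟨(List.cons.inj h).2.symm, h'⟩
      · have h2 := X.reducedSeq_letter_mul x (!s) (X.letter (x, s) * r')
        have e : X.letter (x, !s) * (X.letter (x, s) * r') = r' := by
          rw [letter_not]; simp
        rw [e, Bool.not_not] at h2
        rcases h2 with ⟨-, h2⟩ | h2
        · rw [hw] at h2
          exact absurd rfl h2
        · have h3 := congrArg List.length h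
          rw [h2] at h3
          simp at h3
          omega
    specialize ih r' hr'.1
    have hshift : ∀ S : Set F, {g | g * X.letter (x, s) ∈ S}.encard = S.encard := by
      intro S
      rw [← (mul_left_injective (X.letter (x, s))).encard_image]
      congr 1
      ext g
      constructor
      · rintro ⟨k, hk, rfl⟩
        exact hk
      · exact fun hg => ⟨g * (X.letter (x, s))⁻¹, by simpa using hg, by simp⟩
    rw [← Finset.add_sum_erase _ _ (Finset.mem_univ x)] at ih ⊢
    have h1 : ∀ a ∈ Finset.univ.erase x,
        {g | ¬ (g ∈ X.half (a, true) ↔ g * (X.letter (x, s) * r') ∈ X.half (a, true))}.encard =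
        {g | ¬ (g ∈ X.half (a, true) ↔ g * r' ∈ X.half (a, true))}.encard := by
      intro a ha
      have hax : (a : F) ≠ x := fun h => (Finset.ne_of_mem_erase ha) (Subtype.ext h)
      rw [← hshift {g | ¬ (g ∈ X.half (a, true) ↔ g * r' ∈ X.half (a, true))}]
      congr 1
      ext g
      have h : g ∈ X.half (a, true) ↔ g * X.letter (x, s) ∈ X.half (a, true) := by
        have hA := X.isHalf_half_true a
        constructor
        · intro h1
          by_contra h2
          have h3 := hA.leave (X.letter_mem_signed (x, s)) h1 h2
          cases s
          · exact hax (by simpa [letter] using h3.2.symm)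
          · exact hax (X.eq_of_mem_of_eq_inv a.2 x.2 (.inr (by
              rw [← inv_eq_iff_eq_inv]; simpa [letter, inv_eq_iff_eq_inv] using h3.2.symm)))
        · intro h1
          by_contra h2
          have h3 := hA.enter (X.letter_mem_signed (x, s)) h2 h1
          cases s
          · exact hax (X.eq_of_mem_of_eq_inv a.2 x.2 (.inr (by
              simpa [letter] using h3.2.symm)))
          · exact hax (by simpa [letter] using h3.2.symm)
      simp only [Set.mem_ofPred_eq, ← mul_assoc, h]
    rw [Finset.sum_congr rfl h1]
    have h2 : {g | ¬ (g ∈ X.half (x, true) ↔ g * (X.letter (x, s) * r') ∈ X.half (x, true))}.encard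
        = {g | ¬ (g ∈ X.half (x, true) ↔ g * r' ∈ X.half (x, true))}.encard + 1 := by
      set A := X.half (x, true) with hAdef
      have hA := X.isHalf_half_true x
      rw [← hAdef] at hA
      set y := X.letter (x, s) with hy
      -- `g0` is the position where the first step crosses `A`: it is `x` for an inverse letter and
      -- `1` otherwise. The word is reduced, so after this step the path from `g0` ends on the side
      -- just reached.
      obtain ⟨g0, hg0, hg1⟩ : ∃ g0, (∀ g, ¬ (g ∈ A ↔ g * y ∈ A) ↔ g = g0) ∧
          (g0 * y ∈ A ↔ g0 * y * r' ∈ A) := by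
        cases s
        · refine ⟨x, fun g => ?_, ?_⟩
          · have hyx : y = (x : F)⁻¹ := by simp [hy, letter]
            constructor
            · intro h
              by_cases hg : g ∈ A
              · have h3 := (hA.leave (X.letter_mem_signed (x, false)) hg (by tauto)).1
                rw [← hy, hyx, mul_inv_eq_one] at h3
                exact h3
              · have h3 := (hA.enter (X.letter_mem_signed (x, false)) hg (by tauto)).2
                rw [← hy, hyx] at h3
                exact absurd h3.symm (X.ne_inv_of_mem_signed (X.mem_signed_of_mem x.2))
            · rintro rfl
              have h1 := hA.mem
              have h2 := hA.notMem
              rw [one_mul] at h1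
              simp [hyx, h1, h2]
          · have hyx : y = (x : F)⁻¹ := by simp [hy, letter]
            have h2 := hA.notMem
            have h3 : r' ∉ A := hr'.2
            simp [hyx, h2, h3]
        · have hyx : y = (x : F) := by simp [hy, letter]
          refine ⟨1, fun g => ?_, ?_⟩
          · constructor
            · intro h
              by_cases hg : g ∈ A
              · have h3 := (hA.leave (X.letter_mem_signed (x, true)) hg (by tauto)).2
                rw [← hy, hyx] at h3
                exact absurd h3 (X.ne_inv_of_mem_signed (X.mem_signed_of_mem x.2))
              · exact (hA.enter (X.letter_mem_signed (x, true)) hg (by tauto)).1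
            · rintro rfl
              have h1 := hA.mem
              have h2 := hA.notMem
              rw [one_mul] at h1
              simp [hyx, h1, h2]
          · have h1 := hA.mem
            have h3 : y * r' ∈ A := by
              simp [hAdef, half, hw]
            simp only [one_mul] at h1 ⊢
            simp [hyx, h1]
            simpa [hyx] using h3
      rw [← hshift {g | ¬ (g ∈ A ↔ g * r' ∈ A)}]
      have : {g | ¬ (g ∈ A ↔ g * (y * r') ∈ A)} =
          insert g0 {g | g * y ∈ {g | ¬ (g ∈ A ↔ g * r' ∈ A)}} := by
        ext g
        have h := hg0 g
        simp only [Set.mem_insert_iff, Set.mem_ofPred_eq, ← mul_assoc, ← h]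
        by_cases hgg : g = g0
        · subst hgg
          tauto
        · tauto
      rw [this, Set.encard_insert_of_notMem]
      simpa using hg1
    rw [h2, add_right_comm, ih]
    simp

/-! ### The action of automorphisms on bases -/

/-- The image of a basis under an automorphism. -/
def map (X : FBasis F) (e : F ≃* F) : FBasis F := ⟨e '' X.1, by
  have h : ⇑(FreeGroup.lift (Subtype.val : (e '' X.1 : Set F) → F)) =
      e ∘ X.equiv ∘ FreeGroup.freeGroupCongr (e.toEquiv.image X.1).symm := by
    have : FreeGroup.lift (Subtype.val : (e '' X.1 : Set F) → F) =
        (e.toMonoidHom.comp X.equiv.toMonoidHom).comp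
          (FreeGroup.freeGroupCongr (e.toEquiv.image X.1).symm).toMonoidHom := by
      ext ⟨_, x, hx, rfl⟩
      have : (((e : F ≃ F).image X.1).symm ⟨e x, x, hx, rfl⟩ : F) = x :=
        congrArg Subtype.val
          (((e : F ≃ F).image X.1).symm_apply_eq.2 (Subtype.ext rfl) :
            ((e : F ≃ F).image X.1).symm ⟨e x, x, hx, rfl⟩ = ⟨x, hx⟩)
      simp only [FreeGroup.lift_apply_of, MonoidHom.comp_apply, MulEquiv.coe_toMonoidHom,
        FreeGroup.freeGroupCongr_apply, FreeGroup.map.of, equiv_of]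
      exact congrArg e this.symm
    rw [this]
    rfl
  show Function.Bijective _
  rw [h]
  exact e.bijective.comp (X.equiv.bijective.comp (MulEquiv.bijective _))⟩

@[simp] theorem coe_map (X : FBasis F) (e : F ≃* F) : (X.map e).1 = e '' X.1 := rfl

theorem signed_map (X : FBasis F) (e : F ≃* F) : (X.map e).signed = e '' X.signed := by
  simp only [signed, coe_map, Set.image_union, Set.image_inv]

/-! ### The Whitehead transform replacing a half-space -/

/-- `K` is a union of branches at `1`, given by the letters in `K`. The Whitehead automorphism `θ`
fixes `b` and sends any other letter `c` to `(ε c)⁻¹ * c * ε c⁻¹`. In the tree of the new basis `K`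
is the half-space of `b`, while the other letters keep their half-spaces with a shifted edge, so a
single summand changes. -/
theorem exists_transform_one [Group.FG F] (Y : FBasis F) {K : Set F} {b : F}
    (hb : b ∈ Y.signed) (hw : 1 ∉ K)
    (hK : ∀ g, ∀ c ∈ Y.signed, g ∉ K → g * c ∈ K → g = 1) (h1 : b ∈ K) (h2 : b⁻¹ ∉ K) :
    ∃ Y' : FBasis F, Y.IsWhiteheadTransform Y' ∧
      ∀ (M : Type) [AddCommMonoid M] (φ : Set F → M), (∀ (f : F) A, φ (f • A) = φ A) →
        (∀ A, φ Aᶜ = φ A) → ∀ B u, Y.IsHalf B u b →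
          Y'.cutSum φ + φ B = Y.cutSum φ + φ K := by
  classical
  let ε : F → F := fun c => if c ∈ K then b else 1
  have hε : ∀ c, (c ∈ K ∧ ε c = b) ∨ (c ∉ K ∧ ε c = 1) := by
    intro c
    by_cases h : c ∈ K
    · left; simp [ε, h]
    · right; simp [ε, h]
  -- the automorphism and its inverse
  let θ : F →* F := Y.lift fun c =>
    if (c : F) = b ∨ (c : F) = b⁻¹ then c else (ε c)⁻¹ * c * ε (c : F)⁻¹
  let θ' : F →* F := Y.lift fun c =>
    if (c : F) = b ∨ (c : F) = b⁻¹ then c else ε c * c * (ε (c : F)⁻¹)⁻¹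
  have hθb : θ b = b := by
    rcases hb with hb | hb
    · have := Y.lift_coe (fun c =>
        if (c : F) = b ∨ (c : F) = b⁻¹ then (c : F) else (ε c)⁻¹ * c * ε (c : F)⁻¹) ⟨b, hb⟩
      simpa using this
    · have := Y.lift_coe (fun c =>
        if (c : F) = b ∨ (c : F) = b⁻¹ then (c : F) else (ε c)⁻¹ * c * ε (c : F)⁻¹) ⟨b⁻¹, hb⟩
      simpa using this
  have hθ'b : θ' b = b := by
    rcases hb with hb | hb
    · have := Y.lift_coe (fun c =>
        if (c : F) = b ∨ (c : F) = b⁻¹ then (c : F) else ε c * c * (ε (c : F)⁻¹)⁻¹) ⟨b, hb⟩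
      simpa using this
    · have := Y.lift_coe (fun c =>
        if (c : F) = b ∨ (c : F) = b⁻¹ then (c : F) else ε c * c * (ε (c : F)⁻¹)⁻¹) ⟨b⁻¹, hb⟩
      simpa using this
  have hθε : ∀ c, θ (ε c) = ε c := by
    intro c
    rcases hε c with ⟨-, h⟩ | ⟨-, h⟩ <;> simp [h, hθb]
  have hθ'ε : ∀ c, θ' (ε c) = ε c := by
    intro c
    rcases hε c with ⟨-, h⟩ | ⟨-, h⟩ <;> simp [h, hθ'b]
  have hθY : ∀ c ∈ Y.1, ¬ (c = b ∨ c = b⁻¹) → θ c = (ε c)⁻¹ * c * ε c⁻¹ := by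
    intro c hc h
    have := Y.lift_coe (fun c =>
        if (c : F) = b ∨ (c : F) = b⁻¹ then (c : F) else (ε c)⁻¹ * c * ε (c : F)⁻¹) ⟨c, hc⟩
    simpa [h] using this
  have hθ'Y : ∀ c ∈ Y.1, ¬ (c = b ∨ c = b⁻¹) → θ' c = ε c * c * (ε c⁻¹)⁻¹ := by
    intro c hc h
    have := Y.lift_coe (fun c =>
        if (c : F) = b ∨ (c : F) = b⁻¹ then (c : F) else ε c * c * (ε (c : F)⁻¹)⁻¹) ⟨c, hc⟩
    simpa [h] using this
  have hθs : ∀ c ∈ Y.signed, ¬ (c = b ∨ c = b⁻¹) → θ c = (ε c)⁻¹ * c * ε c⁻¹ := by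
    intro c hc h
    rcases hc with hc | hc
    · exact hθY c hc h
    · have := hθY c⁻¹ hc (by rwa [inv_inj, inv_eq_iff_eq_inv, or_comm])
      rw [map_inv, inv_inv, inv_eq_iff_eq_inv] at this
      rw [this]
      group
  let e : F ≃* F := MonoidHom.toMulEquiv θ θ'
    (Y.hom_ext fun c hc => by
      by_cases h : c = b ∨ c = b⁻¹
      · rcases h with rfl | rfl <;> simp [hθb, hθ'b]
      · simp only [MonoidHom.comp_apply, hθY c hc h, map_mul, map_inv, hθ'ε, hθ'Y c hc h,
          MonoidHom.id_apply]
        group)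
    (Y.hom_ext fun c hc => by
      by_cases h : c = b ∨ c = b⁻¹
      · rcases h with rfl | rfl <;> simp [hθb, hθ'b]
      · simp only [MonoidHom.comp_apply, hθ'Y c hc h, map_mul, map_inv, hθε, hθY c hc h,
          MonoidHom.id_apply]
        group)
  have he : ∀ c, e c = θ c := fun _ => rfl
  -- The letter is `b⁻¹` because `ε`, with values `1` and `b`, enters inverted on the left.
  refine ⟨Y.map e, ⟨b⁻¹, Y.inv_mem_signed hb, ?_⟩, ?_⟩
  · rintro _ ⟨c, hc, rfl⟩
    rw [he]
    by_cases h : c = b ∨ c = b⁻¹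
    · have hc' : θ c = 1 * c * 1 := by rcases h with rfl | rfl <;> simp [hθb]
      rw [hc']
      exact Set.mul_mem_mul (Set.mul_mem_mul (by simp) hc) (by simp)
    · rw [hθY c hc h]
      refine Set.mul_mem_mul (Set.mul_mem_mul ?_ hc) ?_
      · rcases hε c with ⟨-, h⟩ | ⟨-, h⟩ <;> simp [h]
      · rcases hε c⁻¹ with ⟨-, h⟩ | ⟨-, h⟩ <;> simp [h]
  have hs : ∀ x ∈ (Y.map e).signed, ∃ c ∈ Y.signed, x = θ c := by
    intro x hx
    rw [signed_map] at hx
    obtain ⟨c, hc, rfl⟩ := hx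
    exact ⟨c, hc, rfl⟩
  have hs' : ∀ c ∈ Y.signed, θ c ∈ (Y.map e).signed := by
    intro c hc
    rw [signed_map]
    exact ⟨c, hc, rfl⟩
  have hinj : Function.Injective θ := e.injective
  -- the old half-spaces
  have hold : ∀ d ∈ Y.1, ¬ (d = b ∨ d = b⁻¹) → ∀ D, Y.IsHalf D 1 d →
      (Y.map e).IsHalf D (ε d) (θ d) := by
    intro d hd hdb D hD
    -- Only `d`-edges cross the boundary of `D`, so right multiplication by `b` preserves `D`.
    have hDb : ∀ g, g * b ∈ D ↔ g ∈ D := by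
      intro g
      constructor
      · intro h
        by_contra h'
        exact hdb (.inl (hD.enter hb h' h).2.symm)
      · intro h
        by_contra h'
        exact hdb (.inr (by rw [(hD.leave hb h h').2, inv_inv]))
    have hDε : ∀ c g, g * ε c ∈ D ↔ g ∈ D := by
      intro c g
      rcases hε c with ⟨-, h⟩ | ⟨-, h⟩ <;> simp [h, hDb]
    refine ⟨hs' d (Y.mem_signed_of_mem hd), fun g x hx => ?_⟩
    obtain ⟨c, hc, rfl⟩ := hs x hx
    by_cases hcb : c = b ∨ c = b⁻¹
    · have hDc : g * θ c ∈ D ↔ g ∈ D := by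
        rcases hcb with rfl | rfl
        · rw [hθb, hDb]
        · rw [map_inv, hθb, ← hDb (g * b⁻¹)]; simp
      rw [hDc]
      constructor
      · tauto
      · rintro ⟨-, h⟩
        rw [hinj h] at hcb
        exact absurd hcb hdb
    · have e1 : g ∈ D ↔ g * (ε c)⁻¹ ∈ D := by
        rw [← hDε c (g * (ε c)⁻¹)]; simp
      have e2 : g * θ c ∈ D ↔ g * (ε c)⁻¹ * c ∈ D := by
        rw [hθs c hc hcb, ← hDε c⁻¹ (g * (ε c)⁻¹ * c)]
        simp only [mul_assoc]
      rw [e1, e2, hD.2 _ c hc, mul_inv_eq_one, hinj.eq_iff]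
      constructor
      · rintro ⟨rfl, rfl⟩; exact ⟨rfl, rfl⟩
      · rintro ⟨rfl, rfl⟩; exact ⟨rfl, rfl⟩
  -- the new half-space
  have hKleave : ∀ g, ∀ c ∈ Y.signed, g ∈ K → g * c ∉ K → g * c = 1 := by
    intro g c hc h h'
    exact hK (g * c) c⁻¹ (Y.inv_mem_signed hc) h' (by simpa using h)
  have hKb : ∀ k, k * b ∈ K ↔ k ∈ K ∨ k = 1 := by
    intro k
    constructor
    · intro h
      by_contra! h'
      exact h'.2 (hK k b hb h'.1 h)
    · rintro (h | rfl)
      · by_contra h'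
        have := hKleave k b hb h h'
        rw [mul_eq_one_iff_eq_inv] at this
        rw [this] at h
        exact h2 h
      · simpa using h1
  have hKε : ∀ c k, k * ε c ∈ K ↔ k ∈ K ∨ (k = 1 ∧ c ∈ K) := by
    intro c k
    rcases hε c with ⟨h, h'⟩ | ⟨h, h'⟩
    · simp [h, h', hKb]
    · simp [h, h']
  have hnew : (Y.map e).IsHalf K 1 b := by
    refine ⟨by simpa [hθb] using hs' b hb, fun g x hx => ?_⟩
    obtain ⟨c, hc, rfl⟩ := hs x hx
    by_cases hcb : c = b ∨ c = b⁻¹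
    · rcases hcb with rfl | rfl
      · rw [hθb]
        constructor
        · exact fun h => ⟨hK g c hc h.1 h.2, rfl⟩
        · rintro ⟨rfl, -⟩
          exact ⟨hw, by simpa using h1⟩
      · rw [map_inv, hθb]
        constructor
        · intro h
          obtain rfl := hK g b⁻¹ hc h.1 h.2
          simp [h2] at h
        · rintro ⟨-, h⟩
          exact absurd h.symm (Y.ne_inv_of_mem_signed hb)
    · constructor
      · rintro ⟨h3, h4⟩
        exfalso
        apply h3
        -- With `k = g * (ε c)⁻¹` the new edge runs from `k * ε c` to `k * c * ε c⁻¹`. If it ends in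
        -- `K`, then `k * c ∈ K`, or `k = c⁻¹` lies in `K`; in both cases `k * ε c ∈ K`, so the edge
        -- does not enter `K`.
        have e1 : g * θ c = g * (ε c)⁻¹ * c * ε c⁻¹ := by rw [hθs c hc hcb]; group
        have e2 : g = g * (ε c)⁻¹ * ε c := by group
        rw [e1, hKε] at h4
        rw [e2, hKε]
        generalize g * (ε c)⁻¹ = k at h4
        rcases h4 with h4 | ⟨h4, h5⟩
        · by_cases hk : k ∈ K
          · exact .inl hk
          · obtain rfl := hK k c hc hk h4
            exact .inr ⟨rfl, by simpa using h4⟩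
        · rw [mul_eq_one_iff_eq_inv] at h4
          rw [h4]
          exact .inl h5
      · rintro ⟨-, h⟩
        exact absurd (.inl (hinj (by rw [h, hθb]))) hcb
  -- the sums
  intro M _ φ hφs hφc B u hB
  have : Fintype Y.1 := Fintype.ofFinite _
  have : Fintype (Y.map e).1 := Fintype.ofFinite _
  obtain ⟨y0, hy0⟩ : ∃ y0 : Y.1, b = y0 ∨ b = (y0 : F)⁻¹ := by
    rcases hb with hb | hb
    · exact ⟨⟨b, hb⟩, .inl rfl⟩
    · exact ⟨⟨b⁻¹, hb⟩, .inr (by simp)⟩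
  let σ : Y.1 ≃ (Y.map e).1 := e.toEquiv.image Y.1
  have hσ : ∀ y : Y.1, ((σ y : (Y.map e).1) : F) = θ y := fun _ => rfl
  have hmain : ∀ y : Y.1, y ≠ y0 → φ ((Y.map e).half (σ y, true)) = φ (Y.half (y, true)) := by
    intro y hy
    have hyb : ¬ ((y : F) = b ∨ (y : F) = b⁻¹) := by
      intro h
      apply hy
      apply Subtype.ext
      apply Y.eq_of_mem_of_eq_inv y.2 y0.2
      rcases hy0 with h' | h'
      · rwa [h'] at h
      · rw [h', inv_inv] at h; exact h.symm
    exact ((Y.map e).isHalf_half_true (σ y)).apply_eq hφs hφc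
      (hold y y.2 hyb _ (Y.isHalf_half_true y)) (.inl (hσ y))
  have hb0 : φ ((Y.map e).half (σ y0, true)) = φ K := by
    refine ((Y.map e).isHalf_half_true (σ y0)).apply_eq hφs hφc hnew ?_
    rw [hσ]
    rcases hy0 with h | h
    · left; rw [← h, hθb]
    · right; rw [← inv_eq_iff_eq_inv, ← map_inv, ← h, hθb]
  have hB0 : φ B = φ (Y.half (y0, true)) := hB.apply_eq hφs hφc (Y.isHalf_half_true y0) hy0
  rw [cutSum, cutSum, finsum_eq_sum_of_fintype, finsum_eq_sum_of_fintype, ← σ.sum_comp,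
    ← Finset.add_sum_erase _ _ (Finset.mem_univ y0),
    ← Finset.add_sum_erase _ (fun y => φ (Y.half (y, true))) (Finset.mem_univ y0),
    Finset.sum_congr rfl fun y hy => hmain y (Finset.ne_of_mem_erase hy), hb0, hB0]
  abel

/-- A half-space of a basis can be replaced, by a Whitehead transform, by a set all of whose
ingoing edges have the same source and which separates a letter from its inverse. -/
theorem exists_transform [Group.FG F] (Y : FBasis F) {K : Set F} {w b : F}
    (hb : b ∈ Y.signed) (hw : w ∉ K)
    (hK : ∀ g, ∀ c ∈ Y.signed, g ∉ K → g * c ∈ K → g = w) (h1 : w * b ∈ K)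
    (h2 : w * b⁻¹ ∉ K) :
    ∃ Y' : FBasis F, Y.IsWhiteheadTransform Y' ∧
      ∀ (M : Type) [AddCommMonoid M] (φ : Set F → M), (∀ (f : F) A, φ (f • A) = φ A) →
        (∀ A, φ Aᶜ = φ A) → ∀ B u, Y.IsHalf B u b →
          Y'.cutSum φ + φ B = Y.cutSum φ + φ K := by
  have hmem : ∀ g, g ∈ w⁻¹ • K ↔ w * g ∈ K := by
    intro g
    rw [Set.mem_smul_set_iff_inv_smul_mem, inv_inv, smul_eq_mul]
  obtain ⟨Y', h, h'⟩ := Y.exists_transform_one (K := w⁻¹ • K) hb (by rw [hmem]; simpa using hw)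
    (fun g c hc h3 h4 => by
      rw [hmem] at h3 h4
      rw [← mul_assoc] at h4
      simpa using hK _ c hc h3 h4) (by rwa [hmem]) (by rwa [hmem])
  refine ⟨Y', h, fun M _ φ hs hc B u hB => ?_⟩
  rw [h' M φ hs hc B u hB, hs]

end FBasis

/-! ### Weights on pairs of group elements -/

/-- A finitely additive, left-invariant weight on sets of pairs of elements of `F`. -/
structure PairWeight (F : Type*) [Group F] where
  /-- The weight of a set of pairs. -/
  toFun : Set (F × F) → ENNReal
  union' : ∀ S T, Disjoint S T → toFun (S ∪ T) = toFun S + toFun T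
  smul' : ∀ (f : F) S, toFun ((fun p => (f * p.1, f * p.2)) ⁻¹' S) = toFun S

namespace PairWeight

variable {F : Type*} [Group F] (m : PairWeight F) {A B : Set F} {S T S' T' : Set (F × F)}

theorem mono (h : S ⊆ T) : m.toFun S ≤ m.toFun T := by
  rw [← Set.union_sdiff_cancel h, m.union' _ _ Set.disjoint_sdiff_right]
  exact le_self_add

theorem union_add_inter (S T : Set (F × F)) :
    m.toFun (S ∪ T) + m.toFun (S ∩ T) = m.toFun S + m.toFun T := by
  rw [← Set.union_sdiff_self, m.union' _ _ Set.disjoint_sdiff_right, add_assoc, Set.inter_comm,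
    ← m.union' _ _ (Set.disjoint_sdiff_inter), Set.sdiff_union_inter]

theorem add_le_add_of_subset (h1 : S ∪ T ⊆ S' ∪ T') (h2 : S ∩ T ⊆ S' ∩ T') :
    m.toFun S + m.toFun T ≤ m.toFun S' + m.toFun T' := by
  rw [← m.union_add_inter S T, ← m.union_add_inter S' T']
  exact add_le_add (m.mono h1) (m.mono h2)

/-- The weight of the pairs separated by a set. -/
def cap (A : Set F) : ENNReal := m.toFun {p | ¬ (p.1 ∈ A ↔ p.2 ∈ A)}

/-- The weight of the pairs in `B` separated by `A`. -/
def disc (A B : Set F) : ENNReal := m.toFun {p | (p.1 ∈ B ∧ p.2 ∈ B) ∧ ¬ (p.1 ∈ A ↔ p.2 ∈ A)}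

theorem cap_smul (f : F) (A : Set F) : m.cap (f • A) = m.cap A := by
  rw [cap, cap, ← m.smul' f⁻¹ {p | ¬ (p.1 ∈ A ↔ p.2 ∈ A)}]
  simp only [Set.mem_smul_set_iff_inv_smul_mem, smul_eq_mul]
  rfl

theorem cap_compl (A : Set F) : m.cap Aᶜ = m.cap A := by
  simp only [cap, Set.mem_compl_iff, not_iff_not]

theorem disc_smul (f : F) (A B : Set F) : m.disc (f • A) (f • B) = m.disc A B := by
  rw [disc, disc, ← m.smul' f⁻¹ {p | (p.1 ∈ B ∧ p.2 ∈ B) ∧ ¬ (p.1 ∈ A ↔ p.2 ∈ A)}]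
  simp only [Set.mem_smul_set_iff_inv_smul_mem, smul_eq_mul]
  rfl

theorem disc_compl_left (A B : Set F) : m.disc Aᶜ B = m.disc A B := by
  simp only [disc, Set.mem_compl_iff, not_iff_not]

theorem disc_le_cap (A B : Set F) : m.disc A B ≤ m.cap A := m.mono fun _ h => h.2

theorem disc_mono {B B' : Set F} (h : B ⊆ B') (A : Set F) : m.disc A B ≤ m.disc A B' :=
  m.mono fun _ hp => ⟨⟨h hp.1.1, h hp.1.2⟩, hp.2⟩

/-- A pair separated by `A ∩ B` but not by `B` lies inside `B` and is separated by `A`. The pairs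
inside `Aᶜ` separated by `B` are not separated by `A ∩ B`, so they can be added on the left. This is
the gain and loss of cutting `B` down to a corner. -/
theorem cap_inter_add_disc_le (A B : Set F) :
    m.cap (A ∩ B) + m.disc B Aᶜ ≤ m.cap B + m.disc A B := by
  apply m.add_le_add_of_subset
  · rintro ⟨p, q⟩ h
    simp only [Set.mem_union, Set.mem_inter_iff, Set.mem_compl_iff, Set.mem_ofPred_eq] at h ⊢
    tauto
  · rintro ⟨p, q⟩ h
    simp only [Set.mem_inter_iff, Set.mem_compl_iff, Set.mem_ofPred_eq] at h ⊢
    tauto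

/-- The weight counting the translates of a pair `(1, r)`. -/
noncomputable def straight (r : F) : PairWeight F where
  toFun S := ({g | (g, g * r) ∈ S}.encard : ENNReal)
  union' S T h := by
    rw [← ENat.toENNReal_add, ← Set.encard_union_eq]
    · rfl
    · exact Set.disjoint_left.2 fun g h1 h2 => Set.disjoint_left.1 h h1 h2
  smul' f S := by
    congr 1
    rw [← (mul_right_injective f⁻¹).encard_image {g | (g, g * r) ∈ S}]
    congr 1
    ext g
    constructor
    · intro h
      exact ⟨f * g, by simpa [mul_assoc] using h, by simp⟩
    · rintro ⟨k, h, rfl⟩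
      simpa [mul_assoc] using h

theorem cap_straight (r : F) (A : Set F) :
    (straight r).cap A = ({g | ¬ (g ∈ A ↔ g * r ∈ A)}.encard : ENNReal) := rfl

end PairWeight

/-! ### Cut sums as lengths, and finiteness of separation and crossing -/

namespace FBasis

variable {F : Type*} [Group F] {X Y : FBasis F} {A B C S T K : Set F} {u v w a b c g : F}

open PairWeight

theorem cutSum_straight [Group.FG F] (X : FBasis F) (r : F) :
    X.cutSum (straight r).cap = (X.reducedSeq r).length := by
  have : Fintype X.1 := Fintype.ofFinite _
  have h := congrArg (ENat.toENNReal) (X.cutSum_encard r)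
  rw [cutSum, finsum_eq_sum_of_fintype] at h ⊢
  simp only [cap_straight]
  rw [ENat.toENNReal_coe] at h
  rw [← h]
  exact (map_sum ENat.toENNRealRingHom _ _).symm

/-- The weight of a half-space is at most the sum over all half-spaces of the basis. -/
theorem IsHalf.le_cutSum [Group.FG F] {φ : Set F → ENNReal} (hs : ∀ (f : F) A, φ (f • A) = φ A)
    (hc : ∀ A, φ Aᶜ = φ A) (h : X.IsHalf A v a) : φ A ≤ X.cutSum φ := by
  have : Fintype X.1 := Fintype.ofFinite _
  obtain ⟨x, hx⟩ : ∃ x : X.1, a = x ∨ a = (x : F)⁻¹ := by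
    rcases h.1 with h | h
    · exact ⟨⟨a, h⟩, .inl rfl⟩
    · exact ⟨⟨a⁻¹, h⟩, .inr (by simp)⟩
  rw [h.apply_eq hs hc (X.isHalf_half_true x) hx, cutSum, finsum_eq_sum_of_fintype]
  exact Finset.single_le_sum (f := fun y : X.1 => φ (X.half (y, true))) (fun _ _ => zero_le)
    (Finset.mem_univ x)

/-- Half-spaces are almost invariant under right translation. -/
theorem finite_of_mem_halves [Group.FG F] (h : A ∈ X.halves) (r : F) :
    {g | ¬ (g ∈ A ↔ g * r ∈ A)}.Finite := by
  obtain ⟨v, a, h⟩ := h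
  -- The number of separated positions is bounded by the sum over all half-spaces, which is the
  -- length of `r`.
  have h1 := h.le_cutSum (straight r).cap_smul (straight r).cap_compl
  rw [cutSum_straight, cap_straight] at h1
  rw [← Set.encard_lt_top_iff, ← ENat.toENNReal_lt]
  exact h1.trans_lt (ENNReal.natCast_lt_top _)

theorem exists_smul_half (h : A ∈ X.halves) : ∃ (f : F) (l : X.1 × Bool), A = f • X.half l := by
  obtain ⟨v, a, h⟩ := h
  obtain ⟨l, rfl⟩ := X.mem_signed_iff.1 h.1
  exact ⟨_, l, h.eq_smul (X.isHalf_half l)⟩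

theorem half_mem_halves (X : FBasis F) (l : X.1 × Bool) : X.half l ∈ X.halves :=
  (X.isHalf_half l).mem_halves

/-- Only finitely many half-spaces of a basis separate two given elements. -/
theorem finite_separating [Group.FG F] (X : FBasis F) (p q : F) :
    {A | A ∈ X.halves ∧ p ∈ A ∧ q ∉ A}.Finite := by
  have h : ∀ l : X.1 × Bool, {f : F | p ∈ f • X.half l ∧ q ∉ f • X.half l}.Finite := by
    intro l
    refine ((finite_of_mem_halves (X.half_mem_halves l) (p⁻¹ * q)).image
      (fun g => p * g⁻¹)).subset ?_
    rintro f ⟨h1, h2⟩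
    rw [Set.mem_smul_set_iff_inv_smul_mem, smul_eq_mul] at h1 h2
    refine ⟨f⁻¹ * p, ?_, by group⟩
    have : f⁻¹ * p * (p⁻¹ * q) = f⁻¹ * q := by group
    simp only [Set.mem_ofPred_eq, this]
    tauto
  refine (Set.finite_iUnion fun l => (h l).image (fun f => f • X.half l)).subset ?_
  rintro A ⟨hA, h1, h2⟩
  obtain ⟨f, l, rfl⟩ := exists_smul_half hA
  exact Set.mem_iUnion.2 ⟨l, f, ⟨h1, h2⟩, rfl⟩

/-- Only finitely many half-spaces of a basis cross a given half-space of another one. -/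
theorem finite_cross [Group.FG F] (X : FBasis F) {Y : FBasis F} (hB : B ∈ Y.halves) :
    {A | A ∈ X.halves ∧ Cross A B}.Finite := by
  -- `P` consists of the ends of the `X`-edges crossing the boundary of `B`. Both `A` and `Aᶜ` are
  -- connected in the tree of `X`, so if `A` crosses `B` then each of them meets `P`, and `A`
  -- separates two of finitely many points.
  let P : Set F := ⋃ x ∈ X.signed, {g | ¬ (g ∈ B ↔ g * x ∈ B)}
  have hP : P.Finite := X.finite_signed.biUnion fun x _ => finite_of_mem_halves hB x
  have key : ∀ A ∈ X.halves, (A ∩ B).Nonempty → (A ∩ Bᶜ).Nonempty → ∃ p ∈ P, p ∈ A := by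
    rintro A ⟨v, a, hA⟩ h1 ⟨q, hq, hq'⟩
    by_contra! hno
    refine hq' (hA.subset_of_enter (S := A ∩ B) Set.inter_subset_left ?_ h1 hq).2
    rintro g hg x hx ⟨h3, h4⟩
    refine ⟨hg, by_contra fun h5 => hno g ?_ hg⟩
    exact Set.mem_biUnion hx (by simp [h4, h5])
  refine (hP.biUnion fun p _ => hP.biUnion fun q _ => X.finite_separating p q).subset ?_
  rintro A ⟨hA, h1, h2, h3, h4⟩
  obtain ⟨p, hp, hpA⟩ := key A hA h1 h2
  obtain ⟨q, hq, hqA⟩ := key Aᶜ (compl_mem_halves hA) h3 h4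
  exact Set.mem_biUnion hp (Set.mem_biUnion hq ⟨hA, hpA, hqA⟩)

/-! ### The distance between two bases -/

open Classical in
/-- The number of half-spaces of `X` crossing `B`, increased by one if `B` is not
a half-space of `X`. -/
noncomputable def crossing (X : FBasis F) (B : Set F) : ℕ :=
  {A | A ∈ X.halves ∧ Cross A B}.ncard + if B ∈ X.halves then 0 else 1

theorem smul_mem_halves_iff (f : F) : f • A ∈ X.halves ↔ A ∈ X.halves :=
  ⟨fun h => by simpa using smul_mem_halves h f⁻¹, fun h => smul_mem_halves h f⟩

theorem compl_mem_halves_iff : Aᶜ ∈ X.halves ↔ A ∈ X.halves :=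
  ⟨fun h => by simpa using compl_mem_halves h, compl_mem_halves⟩

theorem crossing_smul (X : FBasis F) (f : F) (B : Set F) :
    X.crossing (f • B) = X.crossing B := by
  classical
  rw [crossing, crossing]
  refine congrArg₂ (· + ·) ?_ (if_congr (smul_mem_halves_iff f) rfl rfl)
  rw [← Set.ncard_image_of_injective {A | A ∈ X.halves ∧ Cross A B} (MulAction.injective f)]
  congr 1
  ext A
  constructor
  · rintro ⟨h1, h2⟩
    refine ⟨f⁻¹ • A, ⟨smul_mem_halves h1 _, ?_⟩, by simp⟩
    rw [← cross_smul_iff f]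
    simpa using h2
  · rintro ⟨A, ⟨h1, h2⟩, rfl⟩
    exact ⟨smul_mem_halves h1 _, (cross_smul_iff f).2 h2⟩

theorem crossing_compl (X : FBasis F) (B : Set F) : X.crossing Bᶜ = X.crossing B := by
  classical
  rw [crossing, crossing]
  simp only [cross_compl_right]
  exact congrArg₂ (· + ·) rfl (if_congr compl_mem_halves_iff rfl rfl)

/-- A half-space crossing a corner crosses the whole set. -/
theorem Cross.of_inter (hA : A ∈ X.halves) (hC : C ∈ X.halves) (hAB : Cross A B)
    (h : Cross C (A ∩ B)) : Cross C B := by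
  have hn := not_cross_of_halves hA hC
  obtain ⟨⟨p, hp1, hp2, hp3⟩, ⟨q, hq1, hq2⟩, ⟨r, hr1, hr2, hr3⟩, ⟨s, hs1, hs2⟩⟩ := h
  obtain ⟨-, -, -, ⟨t, ht1, ht2⟩⟩ := hAB
  -- `A` meets both sides of `C`, so `Aᶜ` lies on one side of `C`.
  have hn' : ¬ ((Aᶜ ∩ C).Nonempty ∧ (Aᶜ ∩ Cᶜ).Nonempty) := fun h =>
    hn ⟨⟨p, hp2, hp1⟩, ⟨r, hr2, hr1⟩, h.1, h.2⟩
  refine ⟨⟨p, hp1, hp3⟩, ?_, ⟨r, hr1, hr3⟩, ?_⟩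
  · by_cases hqA : q ∈ A
    · exact ⟨q, hq1, fun h => hq2 ⟨hqA, h⟩⟩
    · exact ⟨t, by_contra fun h => hn' ⟨⟨q, hqA, hq1⟩, ⟨t, ht1, h⟩⟩, ht2⟩
  · by_cases hsA : s ∈ A
    · exact ⟨s, hs1, fun h => hs2 ⟨hsA, h⟩⟩
    · exact ⟨t, fun h => hn' ⟨⟨t, ht1, h⟩, ⟨s, hsA, hs1⟩⟩, ht2⟩

/-- No new crossings arise, and `A` crosses `B` but not its own subset `A ∩ B`. The extra `1` for
not being a half-space of `X` is already charged to `B`. -/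
theorem crossing_inter_lt [Group.FG F] (hA : A ∈ X.halves) (hB : B ∈ Y.halves)
    (hAB : Cross A B) : X.crossing (A ∩ B) < X.crossing B := by
  have hBX : B ∉ X.halves := fun h => not_cross_of_halves hA h hAB
  have h1 : {C | C ∈ X.halves ∧ Cross C (A ∩ B)} ⊂ {C | C ∈ X.halves ∧ Cross C B} := by
    refine ⟨fun C hC => ⟨hC.1, Cross.of_inter hA hC.1 hAB hC.2⟩, fun h => ?_⟩
    obtain ⟨-, -, -, ⟨s, hs1, hs2, hs3⟩, -⟩ := h (show A ∈ _ from ⟨hA, hAB⟩)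
    exact hs1 hs2
  have h2 := Set.ncard_lt_ncard h1 (X.finite_cross hB)
  simp only [crossing, hBX, if_false]
  split_ifs <;> omega

/-! ### Innermost crossings -/

/-- Only finitely many half-spaces of `Y` cross `A`, so a minimal one exists below `B`. -/
theorem exists_leaf [Group.FG F] (hA : A ∈ X.halves) (hB : B ∈ Y.halves) (hAB : Cross A B) :
    ∃ T ⊆ B, T ∈ Y.halves ∧ Cross A T ∧ ∀ C ∈ Y.halves, C ⊆ T → Cross A C → C = T := by
  have hfin : {T | T ∈ Y.halves ∧ Cross T A ∧ T ⊆ B}.Finite :=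
    (Y.finite_cross hA).subset fun T hT => ⟨hT.1, hT.2.1⟩
  obtain ⟨T, hT⟩ := hfin.exists_minimal ⟨B, hB, hAB.symm, subset_rfl⟩
  refine ⟨T, hT.prop.2.2, hT.prop.1, hT.prop.2.1.symm, fun C hC hCT hAC => ?_⟩
  exact (hT.eq_of_le ⟨hC, hAC.symm, hCT.trans hT.prop.2.2⟩ hCT)

/-- If no smaller half-space crosses `A`, then `B` can be replaced by one of the corners
`A ∩ B` and `Aᶜ ∩ B` by a Whitehead transform. -/
theorem exists_transform_corner [Group.FG F] (hB : Y.IsHalf B u b) (hAB : Cross A B)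
    (hleaf : ∀ C ∈ Y.halves, C ⊆ B → Cross A C → C = B) :
    ∃ A', (A' = A ∨ A' = Aᶜ) ∧ ∃ Y' : FBasis F, Y.IsWhiteheadTransform Y' ∧
      ∀ (M : Type) [AddCommMonoid M] (φ : Set F → M), (∀ (f : F) A, φ (f • A) = φ A) →
        (∀ A, φ Aᶜ = φ A) → Y'.cutSum φ + φ B = Y.cutSum φ + φ (A' ∩ B) := by
  -- The claim is symmetric in `A` and `Aᶜ`, so the inner end `u * b` of the edge entering `B` may
  -- be taken outside `A`.
  wlog hwA : u * b ∉ A generalizing A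
  · obtain ⟨A', hA', h⟩ := this (A := Aᶜ) (cross_compl_left.2 hAB)
      (fun C h1 h2 h3 => hleaf C h1 h2 (cross_compl_left.1 h3)) hwA
    rw [compl_compl] at hA'
    exact ⟨A', hA'.symm, h⟩
  have hu := hB.notMem
  have hwB := hB.mem
  obtain ⟨-, -, ⟨s, hs1, hs2⟩, ⟨t, ht1, ht2⟩⟩ := hAB.symm
  -- Inside `B`, every `Y`-edge entering `A` starts at `u * b`. Otherwise its source lies in a
  -- branch `C ⊆ B` at `u * b` that crosses `A`; then `C = B` because `B` is innermost, yet `u * b ∉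
  -- C`.
  have enter : ∀ g, ∀ c ∈ Y.signed, g ∈ B → g ∉ A → g * c ∈ A → g * c ∈ B → g = u * b := by
    intro g c hc h1 h2 h3 h4
    by_contra hne
    obtain ⟨C, c0, hC, hgC⟩ := Y.exists_isHalf_mem hne
    have hgcC : g * c ∈ C := by
      by_contra h
      exact hwA ((hC.leave hc hgC h).1 ▸ h3)
    have huC : u ∉ C := by
      intro huC
      have h5 := hC.enter (Y.inv_mem_signed hB.1) hC.notMem (by simpa using huC)
      have : C = Bᶜ := hC.unique (by rw [← h5.2]; exact hB.compl)
      rw [this] at hgC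
      exact hgC h1
    have hCB : C ⊆ B := by
      have : C ∩ Bᶜ = ∅ := by
        refine Y.eq_empty_of_no_enter (g := u) ?_ (fun h => huC h.1)
        rintro h x hx ⟨h5, h6⟩
        by_cases hhC : h ∈ C
        · refine ⟨hhC, fun hhB => huC ?_⟩
          rw [← (hB.leave hx hhB h6).1]
          exact h5
        · obtain ⟨rfl, rfl⟩ := hC.enter hx hhC h5
          exact absurd ((hB.leave hx hwB h6).1 ▸ h5) huC
      intro p hp
      by_contra hpB
      exact (this ▸ (⟨hp, hpB⟩ : p ∈ C ∩ Bᶜ) : p ∈ (∅ : Set F))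
    have := hleaf C hC.mem_halves hCB ⟨⟨_, h3, hgcC⟩, ⟨s, hs2, fun h => hs1 (hCB h)⟩,
      ⟨g, h2, hgC⟩, ⟨t, ht2, fun h => ht1 (hCB h)⟩⟩
    exact hC.notMem (this ▸ hwB)
  have hwbB : u * b * b ∈ B := by
    by_contra h
    have h5 := (hB.leave hB.1 hwB h).2
    exact Y.ne_inv_of_mem_signed hB.1 h5
  -- `exists_transform` needs a set rooted at `u * b` that separates the directions `b` and `b⁻¹`,
  -- the latter leading to `u ∉ B`. If direction `b` lies in `A`, the set `A ∩ B` serves; otherwise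
  -- `A ∪ Bᶜ`, the complement of `Aᶜ ∩ B`, does.
  by_cases hcase : u * b * b ∈ A
  · obtain ⟨Y', hY', h⟩ := Y.exists_transform (K := A ∩ B) (w := u * b) hB.1 (fun h => hwA h.1)
      (by
        rintro g c hc h1 ⟨h2, h3⟩
        by_cases hgB : g ∈ B
        · exact enter g c hc hgB (fun h => h1 ⟨h, hgB⟩) h2 h3
        · obtain ⟨rfl, rfl⟩ := hB.enter hc hgB h3
          exact absurd h2 hwA) ⟨hcase, hwbB⟩ (by
        rintro ⟨-, h⟩
        rw [mul_inv_cancel_right] at h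
        exact hu h)
    exact ⟨A, .inl rfl, Y', hY', fun M _ φ hs hc => h M φ hs hc B u hB⟩
  · obtain ⟨Y', hY', h⟩ := Y.exists_transform (K := A ∪ Bᶜ) (w := u * b) (b := b⁻¹)
      (Y.inv_mem_signed hB.1) (by
        rintro (h | h)
        · exact hwA h
        · exact h hwB)
      (by
        intro g c hc h1 h2
        simp only [Set.mem_union, Set.mem_compl_iff, not_or, not_not] at h1
        by_cases h3 : g * c ∈ B
        · exact enter g c hc h1.2 h1.1 (h2.resolve_right (not_not.2 h3)) h3
        · have h4 := hB.leave hc h1.2 h3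
          rw [← h4.1, h4.2]
          group) (by
        rw [mul_inv_cancel_right]
        exact .inr hu) (by
        rw [inv_inv]
        rintro (h | h)
        · exact hcase h
        · exact h hwbB)
    refine ⟨Aᶜ, .inr rfl, Y', hY', fun M _ φ hs hc => ?_⟩
    have h3 := h M φ hs hc Bᶜ _ hB.compl
    rw [hc, show A ∪ Bᶜ = (Aᶜ ∩ B)ᶜ by rw [Set.compl_inter, compl_compl], hc] at h3
    exact h3

/-- Up to translation `S` is one of finitely many standard half-spaces, and each of these is crossed
by finitely many half-spaces of `Y`. -/
theorem finite_crossing_values [Group.FG F] (X Y : FBasis F) {M : Type*} (D : Set F → Set F → M)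
    (hD : ∀ (f : F) S T, D (f • S) (f • T) = D S T) :
    {d | ∃ S ∈ X.halves, ∃ T ∈ Y.halves, Cross S T ∧ d = D S T}.Finite := by
  refine (Set.finite_iUnion fun l : X.1 × Bool =>
    (Y.finite_cross (X.half_mem_halves l)).image (D (X.half l))).subset ?_
  rintro _ ⟨S, hS, T, hT, hST, rfl⟩
  obtain ⟨f, l, rfl⟩ := exists_smul_half hS
  refine Set.mem_iUnion.2 ⟨l, f⁻¹ • T, ⟨smul_mem_halves hT _, ?_⟩, ?_⟩
  · rw [cross_smul_left] at hST
    exact hST.symm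
  · rw [← hD f, smul_inv_smul]

/-- There is a crossing pair minimizing a monotone invariant, whose second member is innermost. -/
theorem exists_min_crossing [Group.FG F] (m : PairWeight F)
    (hcr : ∃ S ∈ X.halves, ∃ T ∈ Y.halves, Cross S T) :
    ∃ S ∈ X.halves, ∃ T ∈ Y.halves, Cross S T ∧
      (∀ C ∈ Y.halves, C ⊆ T → Cross S C → C = T) ∧
      ∀ S' ∈ X.halves, ∀ T' ∈ Y.halves, Cross S' T' → m.disc S T ≤ m.disc S' T' := by
  obtain ⟨S0, hS0, T0, hT0, h0⟩ := hcr
  obtain ⟨d, ⟨S, hS, T, hT, hST, rfl⟩, hd⟩ :=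
    (finite_crossing_values X Y m.disc m.disc_smul).exists_minimal ⟨_, S0, hS0, T0, hT0, h0, rfl⟩
  -- `disc` is monotone in its second argument, so passing to an innermost half-space keeps the
  -- minimum.
  obtain ⟨T', hT'T, hT', hST', hleaf⟩ := exists_leaf hS hT hST
  refine ⟨S, hS, T', hT', hST', hleaf, fun S'' hS'' T'' hT'' h => ?_⟩
  refine (m.disc_mono hT'T S).trans ?_
  rcases le_total (m.disc S T) (m.disc S'' T'') with h1 | h1
  · exact h1
  · exact hd ⟨S'', hS'', T'', hT'', h, rfl⟩ h1

/-- Replacing an innermost half-space along a disc of minimal weight. -/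
theorem exists_transform_of_min_disc [Group.FG F] (m : PairWeight F)
    (hS : S ∈ X.halves) (hT : T ∈ Y.halves) (hST : Cross S T)
    (hleaf : ∀ C ∈ Y.halves, C ⊆ T → Cross S C → C = T) :
    ∃ A ∈ X.halves, Cross A T ∧ ∃ Y' : FBasis F, Y.IsWhiteheadTransform Y' ∧
      (∀ (M : Type) [AddCommMonoid M] (φ : Set F → M), (∀ (f : F) A, φ (f • A) = φ A) →
        (∀ A, φ Aᶜ = φ A) → Y'.cutSum φ + φ T = Y.cutSum φ + φ (A ∩ T)) ∧
      m.cap (A ∩ T) + m.disc T Aᶜ ≤ m.cap T + m.disc S T := by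
  obtain ⟨u, b, hT⟩ := hT
  obtain ⟨A, hA, Y', hY', h⟩ := exists_transform_corner hT hST hleaf
  refine ⟨A, ?_, ?_, Y', hY', h, ?_⟩
  · rcases hA with rfl | rfl
    exacts [hS, compl_mem_halves hS]
  · rcases hA with rfl | rfl
    exacts [hST, cross_compl_left.2 hST]
  · have : m.disc S T = m.disc A T := by
      rcases hA with rfl | rfl
      exacts [rfl, (m.disc_compl_left _ _).symm]
    rw [this]
    exact m.cap_inter_add_disc_le A T

end FBasis

namespace FBasis

variable {F : Type*} [Group F] {X Y : FBasis F} {A B C S T K : Set F} {u v w a b c g : F}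

/-! ### Exchange of compatible half-spaces -/

/-- A set crossing no half-space is, up to complement, spanned by directions at one vertex. -/
theorem exists_vertex_of_not_cross (hB : B.Nonempty) (hB' : B ≠ Set.univ)
    (h : ∀ A ∈ X.halves, ¬ Cross A B) :
    ∃ B', (B' = B ∨ B' = Bᶜ) ∧ ∃ v ∉ B', ∀ g, ∀ x ∈ X.signed, g ∉ B' → g * x ∈ B' → g = v := by
  obtain ⟨v, a, ha, hv, hva⟩ : ∃ v a, a ∈ X.signed ∧ v ∉ B ∧ v * a ∈ B := by
    by_contra! hno
    exact hB' (X.eq_univ_of_no_enter (fun g x hx h1 => by_contra fun h2 => hno g x hx h2 h1) hB)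
  -- If an edge entered `B` from some `g ≠ v`, the branch `C` at `v` containing `g` would cross `B`;
  -- it differs from `A` because `g ∉ B`.
  have key : ∀ B : Set F, (∀ A ∈ X.halves, ¬ Cross A B) → ∀ v a A, X.IsHalf A v a → v ∉ B →
      v * a ∈ B → A ⊆ B → ∀ g, ∀ x ∈ X.signed, g ∉ B → g * x ∈ B → g = v := by
    intro B h v a A hA hv hva hAB g x hx h1 h2
    by_contra hne
    obtain ⟨C, c, hC, hgC⟩ := X.exists_isHalf_mem hne
    have hgxC : g * x ∈ C := by
      by_contra h3
      exact hv ((hC.leave hx hgC h3).1 ▸ h2)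
    refine h C hC.mem_halves ⟨⟨_, hgxC, h2⟩, ⟨g, hgC, h1⟩, ⟨v * a, fun h3 => ?_, hva⟩,
      ⟨v, hC.notMem, hv⟩⟩
    have h4 := hC.enter hA.1 hC.notMem h3
    have : A = C := hA.unique (by rw [h4.2]; exact hC)
    exact h1 (hAB (this ▸ hgC))
  obtain ⟨A, hA⟩ := X.exists_isHalf v ha
  -- As `A` and `B` do not cross, meet in `v * a` and both miss `v`, one contains the other. The
  -- case `B ⊆ A` is the first case for complements.
  by_cases hAB : A ⊆ B
  · exact ⟨B, .inl rfl, v, hv, key B h v a A hA hv hva hAB⟩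
  · have hBA : B ⊆ A := by
      intro p hp
      by_contra hpA
      obtain ⟨q, hq, hqB⟩ := Set.not_subset.1 hAB
      exact h A hA.mem_halves ⟨⟨_, hA.mem, hva⟩, ⟨q, hq, hqB⟩, ⟨p, hpA, hp⟩, ⟨v, hA.notMem, hv⟩⟩
    refine ⟨Bᶜ, .inr rfl, v * a, by simpa using hva, ?_⟩
    exact key Bᶜ (fun A hA => by rw [cross_compl_right]; exact h A hA) (v * a) a⁻¹ Aᶜ hA.compl
      (by simpa using hva) (by simpa using hv) (Set.compl_subset_compl.2 hBA)

open Classical in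
/-- The number of translates of `B` entered minus the number of translates left on the way
from `1` to `g`. -/
noncomputable def coef (B : Set F) (g : F) : ℤ :=
  ∑ᶠ h, ((if h * g ∈ B then 1 else 0) - if h ∈ B then 1 else 0)

theorem coef_one (B : Set F) : coef B 1 = 0 := by
  rw [coef, ← finsum_zero (α := F)]
  refine finsum_congr fun h => ?_
  by_cases h1 : h ∈ B <;> simp [h1]

theorem coef_support (B : Set F) (r : F) [DecidablePred (· ∈ B)] :
    (Function.support fun h => (((if h * r ∈ B then 1 else 0) - if h ∈ B then 1 else 0 : ℤ))) =
      {g | ¬ (g ∈ B ↔ g * r ∈ B)} := by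
  ext h
  simp only [Function.mem_support, Set.mem_ofPred_eq]
  by_cases h1 : h ∈ B <;> by_cases h2 : h * r ∈ B <;> simp [h1, h2]

/-- Almost invariance makes the sums finite, and shifting one of them by `p` makes them telescope.
Thus `coef B` is a homomorphism to `ℤ`. -/
theorem coef_mul (hB : ∀ r, {g | ¬ (g ∈ B ↔ g * r ∈ B)}.Finite) (p q : F) :
    coef B (p * q) = coef B p + coef B q := by
  classical
  have h1 : coef B q =
      ∑ᶠ h, ((if h * p * q ∈ B then 1 else 0) - if h * p ∈ B then 1 else 0 : ℤ) :=
    (finsum_comp_equiv (Equiv.mulRight p)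
      (f := fun h => ((if h * q ∈ B then 1 else 0) - if h ∈ B then 1 else 0 : ℤ))).symm
  rw [h1, coef, coef, ← finsum_add_distrib]
  · refine finsum_congr fun h => ?_
    rw [mul_assoc]
    ring
  · rw [Function.HasFiniteSupport, coef_support]
    exact hB p
  · have : (Function.support fun h => ((if h * p * q ∈ B then 1 else 0) -
        if h * p ∈ B then 1 else 0 : ℤ)) = (Equiv.mulRight p) ⁻¹' {g | ¬ (g ∈ B ↔ g * q ∈ B)} := by
      rw [← coef_support B q]
      rfl
    rw [Function.HasFiniteSupport, this]
    exact (hB q).preimage (Equiv.injective _).injOn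

theorem coef_inv (hB : ∀ r, {g | ¬ (g ∈ B ↔ g * r ∈ B)}.Finite) (p : F) :
    coef B p⁻¹ = - coef B p := by
  have := coef_mul hB p p⁻¹
  rw [mul_inv_cancel, coef_one] at this
  omega

theorem coef_compl (B : Set F) (g : F) : coef Bᶜ g = - coef B g := by
  classical
  rw [coef, coef, ← finsum_neg_distrib]
  refine finsum_congr fun h => ?_
  by_cases h1 : h ∈ B <;> by_cases h2 : h * g ∈ B <;> simp [h1, h2]

-- The half-spaces at `1` give coordinates dual to `X`: among the edges labelled by elements of `X`,
-- only the one from `1` to `x` crosses the boundary.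
open Classical in
theorem coef_half (x y : X.1) : coef (X.half (x, true)) y = if x = y then 1 else 0 := by
  have hx := X.isHalf_half_true x
  rw [coef, finsum_eq_single _ 1]
  · have h1 := hx.notMem
    have h2 := hx.2 1 y (X.mem_signed_of_mem y.2)
    simp only [h1, not_false_eq_true, one_mul, true_and, if_false, sub_zero] at h2 ⊢
    refine if_congr (h2.trans ?_) rfl rfl
    rw [eq_comm, Subtype.ext_iff]
  · intro h hh
    by_cases h1 : h ∈ X.half (x, true) <;> by_cases h2 : h * y ∈ X.half (x, true)
    · simp [h1, h2]
    · have h3 := (hx.leave (X.mem_signed_of_mem y.2) h1 h2).2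
      exact absurd y.2 (h3 ▸ X.inv_notMem x.2)
    · exact absurd (hx.enter (X.mem_signed_of_mem y.2) h1 h2).1 hh
    · simp [h1, h2]

/-- Both sides are homomorphisms in `g` that agree on `X` by duality. This is a change of
coordinates in the abelianization. -/
theorem coef_eq_sum [Group.FG F] (X : FBasis F)
    (hB : ∀ r, {g | ¬ (g ∈ B ↔ g * r ∈ B)}.Finite) (g : F) :
    coef B g = ∑ᶠ x : X.1, coef B x * coef (X.half (x, true)) g := by
  classical
  have : Fintype X.1 := Fintype.ofFinite _
  have hX : ∀ x : X.1, ∀ r, {g | ¬ (g ∈ X.half (x, true) ↔ g * r ∈ X.half (x, true))}.Finite :=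
    fun x => finite_of_mem_halves (X.half_mem_halves _)
  rw [finsum_eq_sum_of_fintype]
  have hg : g ∈ Subgroup.closure X.1 := by rw [X.closure_eq_top]; trivial
  induction hg using Subgroup.closure_induction with
  | mem y hy =>
    rw [Finset.sum_eq_single ⟨y, hy⟩]
    · have h := coef_half (X := X) ⟨y, hy⟩ ⟨y, hy⟩
      rw [if_pos rfl] at h
      exact (by rw [h, mul_one] :
        coef B y = coef B y * coef (X.half (⟨y, hy⟩, true)) ((⟨y, hy⟩ : X.1) : F))
    · intro x _ hx
      have h := coef_half (X := X) x ⟨y, hy⟩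
      rw [if_neg hx] at h
      exact mul_eq_zero_of_right _ h
    · simp
  | one => simp [coef_one]
  | mul p q _ _ hp hq =>
    rw [coef_mul hB, hp, hq, ← Finset.sum_add_distrib]
    refine Finset.sum_congr rfl fun x _ => ?_
    rw [coef_mul (hX x), mul_add]
  | inv p _ hp =>
    rw [coef_inv hB, hp, ← Finset.sum_neg_distrib]
    refine Finset.sum_congr rfl fun x _ => ?_
    rw [coef_inv (hX x), mul_neg]

/-- A basis element occurring with nonzero coefficient can be exchanged. -/
theorem exists_transform_exchange [Group.FG F] (X : FBasis F) (x : X.1) (hB : B.Nonempty)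
    (hB' : B ≠ Set.univ) (h : ∀ A ∈ X.halves, ¬ Cross A B) (hx : coef B x ≠ 0) :
    ∃ X' : FBasis F, X.IsWhiteheadTransform X' ∧
      ∀ (M : Type) [AddCommMonoid M] (φ : Set F → M), (∀ (f : F) A, φ (f • A) = φ A) →
        (∀ A, φ Aᶜ = φ A) → X'.cutSum φ + φ (X.half (x, true)) = X.cutSum φ + φ B := by
  classical
  obtain ⟨B', hBB', v, hv, hB'⟩ := exists_vertex_of_not_cross hB hB' h
  have hx' : coef B' x ≠ 0 := by
    rcases hBB' with rfl | rfl
    · exact hx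
    · rwa [coef_compl, neg_ne_zero]
  have hφ : ∀ {M : Type} [AddCommMonoid M] (φ : Set F → M), (∀ A, φ Aᶜ = φ A) → φ B' = φ B := by
    intro M _ φ hc
    rcases hBB' with rfl | rfl
    exacts [rfl, hc B]
  have hxs := X.mem_signed_of_mem x.2
  have hin : ∀ h, h ∉ B' → h * x ∈ B' → h = v := fun h => hB' h x hxs
  have hout : ∀ h, h ∈ B' → h * x ∉ B' → h = v * (x : F)⁻¹ := fun h h1 h2 => by
    rw [← hB' (h * x) (x : F)⁻¹ (X.inv_mem_signed hxs) h2 (by simpa using h1)]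
    simp
  have hH := X.isHalf_half_true x
  -- All edges entering `B'` start at `v`, so `coef B' x` is the indicator of `v * x ∈ B'` minus
  -- that of `v * x⁻¹ ∈ B'`. It is nonzero exactly when `B'` separates the two directions, as
  -- `exists_transform` requires.
  by_cases h1 : v * x ∈ B'
  · by_cases h2 : v * (x : F)⁻¹ ∈ B'
    · exfalso
      apply hx'
      have hne : v ≠ v * (x : F)⁻¹ := fun h => hv (h ▸ h2)
      rw [coef, finsum_eq_sum_of_support_subset (s := {v, v * (x : F)⁻¹})]
      · rw [Finset.sum_pair hne]
        simp [hv, h1, h2]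
      · rw [coef_support]
        intro h hh
        simp only [Finset.coe_insert, Finset.coe_singleton, Set.mem_insert_iff,
          Set.mem_singleton_iff]
        by_cases h3 : h ∈ B'
        · exact .inr (hout h h3 fun h4 => hh (by tauto))
        · exact .inl (hin h h3 (by_contra fun h4 => hh (by tauto)))
    · obtain ⟨X', hX', h3⟩ := X.exists_transform hxs hv hB' h1 h2
      exact ⟨X', hX', fun M _ φ hs hc => by rw [h3 M φ hs hc _ _ hH, hφ φ hc]⟩
  · by_cases h2 : v * (x : F)⁻¹ ∈ B'
    · obtain ⟨X', hX', h3⟩ := X.exists_transform (X.inv_mem_signed hxs) hv hB' h2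
        (by rwa [inv_inv])
      exact ⟨X', hX', fun M _ φ hs hc => by
        have h4 := h3 M φ hs hc _ _ hH.compl
        rwa [hc, hφ φ hc] at h4⟩
    · exfalso
      apply hx'
      rw [coef, ← finsum_zero (α := F)]
      refine finsum_congr fun h => ?_
      by_cases h3 : h ∈ B' <;> by_cases h4 : h * x ∈ B'
      · simp [h3, h4]
      · exact absurd (hout h h3 h4 ▸ h3) h2
      · exact absurd (hin h h3 h4 ▸ h4) h1
      · simp [h3, h4]

theorem IsHalf.nonempty (h : X.IsHalf A v a) : A.Nonempty := ⟨_, h.mem⟩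

theorem IsHalf.ne_univ (h : X.IsHalf A v a) : A ≠ Set.univ := fun h' => h.notMem (h' ▸ trivial)

/-- Symmetric exchange between compatible bases. -/
theorem exists_exchange [Group.FG F] (h : ∀ A ∈ X.halves, ∀ B ∈ Y.halves, ¬ Cross A B)
    (y : Y.1) : ∃ x : X.1,
      (∃ X' : FBasis F, X.IsWhiteheadTransform X' ∧
        ∀ (M : Type) [AddCommMonoid M] (φ : Set F → M), (∀ (f : F) A, φ (f • A) = φ A) →
          (∀ A, φ Aᶜ = φ A) →
            X'.cutSum φ + φ (X.half (x, true)) = X.cutSum φ + φ (Y.half (y, true))) ∧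
      (∃ Y' : FBasis F, Y.IsWhiteheadTransform Y' ∧
        ∀ (M : Type) [AddCommMonoid M] (φ : Set F → M), (∀ (f : F) A, φ (f • A) = φ A) →
          (∀ A, φ Aᶜ = φ A) →
            Y'.cutSum φ + φ (Y.half (y, true)) = Y.cutSum φ + φ (X.half (x, true))) := by
  classical
  -- Expanding `coef (Y.half (y, true)) y = 1` in the coordinates dual to `X` gives a nonzero
  -- product of two coefficients. One factor permits the exchange in `X`, the other the exchange in
  -- `Y`.
  have hy := X.coef_eq_sum (finite_of_mem_halves (Y.half_mem_halves (y, true))) y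
  rw [coef_half, if_pos rfl] at hy
  obtain ⟨x, hx⟩ : ∃ x : X.1, coef (Y.half (y, true)) x * coef (X.half (x, true)) y ≠ 0 := by
    by_contra! h0
    rw [finsum_congr h0, finsum_zero] at hy
    exact one_ne_zero hy
  refine ⟨x, X.exists_transform_exchange x (Y.isHalf_half_true y).nonempty
    (Y.isHalf_half_true y).ne_univ (fun A hA => h A hA _ (Y.half_mem_halves _))
    (left_ne_zero_of_mul hx), Y.exists_transform_exchange y (X.isHalf_half_true x).nonempty
    (X.isHalf_half_true x).ne_univ (fun A hA hc => h _ (X.half_mem_halves _) A hA hc.symm)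
    (right_ne_zero_of_mul hx)⟩

theorem crossing_eq_zero (h : A ∈ X.halves) : X.crossing A = 0 := by
  have : {C | C ∈ X.halves ∧ Cross C A} = ∅ :=
    Set.eq_empty_of_forall_notMem fun C hC => not_cross_of_halves hC.1 h hC.2
  rw [crossing, if_pos h, this, Set.ncard_empty]

theorem crossing_pos (h : A ∉ X.halves) : 0 < X.crossing A := by
  rw [crossing, if_neg h]
  omega

/-! ### Approaching a local minimum -/

/-- Given a local minimum `X`, every essentially different basis has a Whitehead transform of no
greater height which is closer to `X`. -/
theorem exists_transform_le [Group.FG F] (m : PairWeight F) (hX : X.cutSum m.cap ≠ ⊤)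
    (hY : Y.cutSum m.cap ≠ ⊤)
    (hmin : ∀ X' : FBasis F, X.IsWhiteheadTransform X' → X.cutSum m.cap ≤ X'.cutSum m.cap)
    (hne : ¬ Y.halves ⊆ X.halves) :
    ∃ Y' : FBasis F, Y.IsWhiteheadTransform Y' ∧ Y'.cutSum m.cap ≤ Y.cutSum m.cap ∧
      Y'.cutSum X.crossing < Y.cutSum X.crossing := by
  have hfin : ∀ Z : FBasis F, Z.cutSum m.cap ≠ ⊤ → ∀ A ∈ Z.halves, m.cap A ≠ ⊤ := by
    rintro Z hZ A ⟨v, a, hA⟩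
    exact ne_top_of_le_ne_top hZ (hA.le_cutSum m.cap_smul m.cap_compl)
  by_cases hcr : ∃ S ∈ X.halves, ∃ T ∈ Y.halves, Cross S T
  · have hcr' : ∃ S ∈ Y.halves, ∃ T ∈ X.halves, Cross S T := by
      obtain ⟨S, hS, T, hT, h⟩ := hcr
      exact ⟨T, hT, S, hS, h.symm⟩
    -- `disc` is minimized in both orders: pairs inside half-spaces of `Y` cut by those of `X`, and
    -- conversely.
    obtain ⟨S, hS, T, hT, hST, hleaf, hd⟩ := exists_min_crossing m hcr
    obtain ⟨P, hP, Q, hQ, hPQ, hleaf', hd'⟩ := exists_min_crossing m hcr'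
    obtain ⟨A, hA, hAT, Y', hY', hsum, hcap⟩ := exists_transform_of_min_disc m hS hT hST hleaf
    obtain ⟨B, hB, hBQ, X', hX', hsum', hcap'⟩ := exists_transform_of_min_disc m hP hQ hPQ hleaf'
    have hSf : m.disc S T ≠ ⊤ := ne_top_of_le_ne_top (hfin X hX S hS) (m.disc_le_cap _ _)
    have hPf : m.disc P Q ≠ ⊤ := ne_top_of_le_ne_top (hfin Y hY P hP) (m.disc_le_cap _ _)
    -- The basis to change is decided by the smaller minimum. Here `disc S T` is at most `disc T
    -- Aᶜ`, so replacing `T` by `A ∩ T` does not raise its weight.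
    rcases le_or_gt (m.disc S T) (m.disc P Q) with hle | hlt
    · refine ⟨Y', hY', ?_, ?_⟩
      · have h1 : m.disc S T ≤ m.disc T Aᶜ :=
          hle.trans (hd' T hT Aᶜ (compl_mem_halves hA) (cross_compl_right.2 hAT.symm))
        have h2 : m.cap (A ∩ T) ≤ m.cap T :=
          ENNReal.le_of_add_le_add_right hSf ((add_le_add_right h1 _).trans hcap)
        have h3 := hsum _ m.cap m.cap_smul m.cap_compl
        refine ENNReal.le_of_add_le_add_right (hfin Y hY T hT) ?_
        rw [h3]
        exact add_le_add_right h2 _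
      · have h1 := crossing_inter_lt hA hT hAT
        have h3 := hsum _ X.crossing X.crossing_smul X.crossing_compl
        omega
    -- In the other order the same estimate is strict and would lower the height of `X`, against
    -- local minimality.
    · exfalso
      have h1 : m.disc P Q < m.disc Q Bᶜ :=
        hlt.trans_le (hd Q hQ Bᶜ (compl_mem_halves hB) (cross_compl_right.2 hBQ.symm))
      have hQf := hfin X hX Q hQ
      have h2 : m.cap (B ∩ Q) < m.cap Q := by
        by_contra! h
        exact absurd hcap' (not_le.2 ((ENNReal.add_lt_add_left hQf h1).trans_le
          (add_le_add_left h _)))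
      have h3 := hsum' _ m.cap m.cap_smul m.cap_compl
      have h4 := add_le_add_left (hmin X' hX') (m.cap Q)
      rw [h3] at h4
      exact absurd h4 (not_le.2 (ENNReal.add_lt_add_left hX h2))
  · push Not at hcr
    obtain ⟨B, hB, hBX⟩ := Set.not_subset.1 hne
    obtain ⟨y, hy⟩ : ∃ y : Y.1, Y.half (y, true) ∉ X.halves := by
      obtain ⟨v, b, hB⟩ := hB
      have key : ∀ y : Y.1, ∀ B v, Y.IsHalf B v y → B ∉ X.halves → Y.half (y, true) ∉ X.halves := by
        intro y B v hB hBX h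
        rw [hB.eq_smul (Y.isHalf_half_true y), smul_mem_halves_iff] at hBX
        exact hBX h
      rcases hB.1 with hb | hb
      · exact ⟨⟨b, hb⟩, key ⟨b, hb⟩ B v hB hBX⟩
      · exact ⟨⟨b⁻¹, hb⟩, key ⟨b⁻¹, hb⟩ Bᶜ _ hB.compl (by rwa [compl_mem_halves_iff])⟩
    obtain ⟨x, ⟨X', hX', hsum'⟩, ⟨Y', hY', hsum⟩⟩ := exists_exchange hcr y
    refine ⟨Y', hY', ?_, ?_⟩
    -- `X'` trades the half-space of `x` for that of `y`, so local minimality says the former weighs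
    -- no more. `Y'` makes the opposite trade.
    · have h1 := hsum' _ m.cap m.cap_smul m.cap_compl
      have h2 := add_le_add_left (hmin X' hX') (m.cap (X.half (x, true)))
      rw [h1] at h2
      have h3 : m.cap (X.half (x, true)) ≤ m.cap (Y.half (y, true)) :=
        ENNReal.le_of_add_le_add_left hX h2
      have h4 := hsum _ m.cap m.cap_smul m.cap_compl
      refine ENNReal.le_of_add_le_add_right (hfin Y hY _ (Y.half_mem_halves (y, true))) ?_
      rw [h4]
      exact add_le_add_right h3 _
    · have h1 := crossing_pos hy
      have h2 := crossing_eq_zero (X.half_mem_halves (x, true))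
      have h3 := hsum _ X.crossing X.crossing_smul X.crossing_compl
      omega

/-- If all half-spaces of `Y` are half-spaces of `X`, then `X` and `Y` agree up to inversion. -/
theorem signed_eq_of_halves_subset (h : Y.halves ⊆ X.halves) : Y.signed = X.signed := by
  have h1 : X.signed ⊆ Y.signed := by
    -- A half-space of `Y` containing `x` but not `1` is a half-space of `X` entered by the edge
    -- from `1` to `x`, so it is unique. Hence `1` and `x` are adjacent in the tree of `Y`.
    intro x hx
    obtain ⟨B, b, hB, hxB⟩ := Y.exists_isHalf_mem (X.ne_one_of_mem_signed hx)
    obtain ⟨v, a, hBX⟩ := h hB.mem_halves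
    have e1 := hBX.enter hx hB.notMem (by simpa using hxB)
    by_cases hxb : x = b
    · exact hxb ▸ hB.1
    · exfalso
      obtain ⟨C, c, hC, hxC⟩ := Y.exists_isHalf_mem hxb
      obtain ⟨v', a', hCX⟩ := h hC.mem_halves
      by_cases h1C : 1 ∈ C
      · have e2 := hC.leave (g := 1) hB.1 h1C (by simpa using hC.notMem)
        have : C = Bᶜ := hC.unique (by
          have h4 := hB.compl
          rw [e2.2, inv_inv, ← e2.2, one_mul] at h4
          exact h4)
        exact (this ▸ hxC : x ∈ Bᶜ) hxB
      · have e2 := hCX.enter hx h1C (by simpa using hxC)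
        have : C = B := hCX.unique (by rw [← e2.1, ← e2.2, e1.1, e1.2]; exact hBX)
        exact hC.notMem (this ▸ (by simpa using hB.mem))
  refine Set.Subset.antisymm ?_ h1
  intro y hy
  obtain ⟨B, hB⟩ := Y.exists_isHalf 1 hy
  obtain ⟨v, a, hBX⟩ := h hB.mem_halves
  have := hB.enter (h1 hBX.1) hBX.notMem hBX.mem
  exact this.2 ▸ hBX.1

theorem cutSum_congr [Group.FG F] (h : Y.signed = X.signed) {M : Type*} [AddCommMonoid M]
    {φ : Set F → M} (hs : ∀ (f : F) A, φ (f • A) = φ A) (hc : ∀ A, φ Aᶜ = φ A) :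
    Y.cutSum φ = X.cutSum φ := by
  have hex : ∀ {X Y : FBasis F}, Y.signed = X.signed → ∀ y : Y.1,
      ∃ x : X.1, (y : F) = x ∨ (y : F) = (x : F)⁻¹ := by
    intro X Y h y
    have := h ▸ Y.mem_signed_of_mem y.2
    rcases this with h | h
    · exact ⟨⟨y, h⟩, .inl rfl⟩
    · exact ⟨⟨_, h⟩, .inr (by simp)⟩
  choose f hf using hex h
  have hf' : Function.Bijective f := by
    constructor
    · intro y y' hyy
      have h1 := hf y
      have h2 := hf y'
      rw [hyy] at h1
      apply Subtype.ext
      apply Y.eq_of_mem_of_eq_inv y.2 y'.2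
      rcases h1 with h1 | h1 <;> rcases h2 with h2 | h2 <;> simp [h1, h2]
    · intro x
      obtain ⟨y, hy⟩ := hex h.symm x
      refine ⟨y, Subtype.ext (X.eq_of_mem_of_eq_inv (f y).2 x.2 ?_)⟩
      have h2 := hf y
      rcases hy with hy | hy
      · rw [← hy] at h2
        rcases h2 with h2 | h2
        exacts [.inl h2.symm, .inr (by rw [h2, inv_inv])]
      · rw [hy]
        rcases h2 with h2 | h2
        exacts [.inr (by rw [inv_inv, h2]), .inl (by rw [h2, inv_inv])]
  refine finsum_eq_of_bijective f hf' fun y => ?_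
  refine (Y.isHalf_half_true y).apply_eq hs hc (X := Y) (b := f y) (u := 1) ?_ (hf y)
  have := X.isHalf_half_true (f y)
  exact ⟨h ▸ this.1, fun g x hx => this.2 g x (h ▸ hx)⟩

end FBasis

namespace FBasis

open Filter Topology PairWeight

variable {F : Type*} [Group F] {X Y : FBasis F}

/-! ### Lengths of powers and of cyclic words -/

theorem length_reducedSeq_mul_le (X : FBasis F) (g h : F) :
    (X.reducedSeq (g * h)).length ≤ (X.reducedSeq g).length + (X.reducedSeq h).length := by
  classical
  simp only [reducedSeq, map_mul]
  exact FreeGroup.norm_mul_le _ _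

theorem length_reducedSeq_inv (X : FBasis F) (g : F) :
    (X.reducedSeq g⁻¹).length = (X.reducedSeq g).length := by
  classical
  simp only [reducedSeq, map_inv]
  exact FreeGroup.norm_inv_eq

open Classical in
/-- The cyclic length of an element. -/
noncomputable def cycLength (X : FBasis F) (g : F) : ℕ :=
  (FreeGroup.reduceCyclically (X.reducedSeq g)).length

/-- Write `g` as a reduced product `u * s * u⁻¹` with `s` cyclically reduced. For `k ≠ 0` the
product `u * s ^ k * u⁻¹` is still reduced, so `p` is twice the length of `u`. -/
theorem exists_length_pow (X : FBasis F) (g : F) :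
    ∃ p : ℕ, ∀ k : ℕ, k ≠ 0 → (X.reducedSeq (g ^ k)).length = p + k * X.cycLength g := by
  classical
  refine ⟨2 * (FreeGroup.reduceCyclically.conjugator (X.reducedSeq g)).length, fun k hk => ?_⟩
  have h := FreeGroup.reduceCyclically.reduce_flatten_replicate
    (FreeGroup.isReduced_toWord (x := X.equiv.symm g)) k
  have h1 : X.reducedSeq (g ^ k) =
      FreeGroup.reduce (List.replicate k (X.reducedSeq g)).flatten := by
    simp only [reducedSeq, map_pow, FreeGroup.toWord_pow]
  rw [h1]
  change FreeGroup.reduce (List.replicate k (X.reducedSeq g)).flatten = _ at h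
  rw [h, if_neg hk, cycLength]
  simp only [List.length_append, List.length_flatten, List.map_replicate, List.sum_replicate,
    FreeGroup.invRev_length, smul_eq_mul]
  simp only [reducedSeq]
  ring

theorem tendsto_div_nat (p q : ℕ) :
    Tendsto (fun k : ℕ => (((p + k * q : ℕ) : ENNReal)) / k) atTop (𝓝 q) := by
  have h1 : Tendsto (fun k : ℕ => (p : ENNReal) * (k : ENNReal)⁻¹ + q) atTop (𝓝 (p * 0 + q)) :=
    (ENNReal.Tendsto.const_mul ENNReal.tendsto_inv_nat_nhds_zero
      (.inr (ENNReal.natCast_ne_top p))).add tendsto_const_nhds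
  rw [mul_zero, zero_add] at h1
  refine h1.congr' ?_
  filter_upwards [eventually_ne_atTop 0] with k hk
  rw [div_eq_mul_inv, Nat.cast_add, Nat.cast_mul, add_mul, mul_right_comm,
    ENNReal.mul_inv_cancel (by simpa using hk) (ENNReal.natCast_ne_top k), one_mul]

theorem tendsto_cycLength (X : FBasis F) (g : F) :
    Tendsto (fun k : ℕ => ((X.reducedSeq (g ^ k)).length : ENNReal) / k) atTop
      (𝓝 (X.cycLength g)) := by
  obtain ⟨p, hp⟩ := X.exists_length_pow g
  refine (tendsto_div_nat p (X.cycLength g)).congr' ?_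
  filter_upwards [eventually_ne_atTop 0] with k hk
  rw [hp k hk]

/-- Conjugation by `h` adds at most twice the length of `h` to every power, which vanishes after
division by `k`. -/
theorem cycLength_conj_le (X : FBasis F) (g h : F) :
    X.cycLength (h * g * h⁻¹) ≤ X.cycLength g := by
  obtain ⟨p, hp⟩ := X.exists_length_pow g
  have h1 := X.tendsto_cycLength (h * g * h⁻¹)
  have h2 := tendsto_div_nat (p + 2 * (X.reducedSeq h).length) (X.cycLength g)
  have h3 := le_of_tendsto_of_tendsto h1 h2 (by
    filter_upwards [eventually_ne_atTop 0] with k hk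
    gcongr
    rw [conj_pow]
    have e1 := X.length_reducedSeq_mul_le (h * g ^ k) h⁻¹
    have e2 := X.length_reducedSeq_mul_le h (g ^ k)
    rw [X.length_reducedSeq_inv] at e1
    rw [hp k hk] at e2
    omega)
  exact_mod_cast h3

theorem cycLength_eq_of_isConj (X : FBasis F) {g h : F} (hgh : IsConj g h) :
    X.cycLength g = X.cycLength h := by
  have key : ∀ {g h : F}, IsConj g h → X.cycLength h ≤ X.cycLength g := by
    intro g h hgh
    obtain ⟨c, rfl⟩ := isConj_iff.1 hgh
    exact X.cycLength_conj_le g c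
  exact (key hgh.symm).antisymm (key hgh)

theorem cycLength_le (X : FBasis F) (g : F) : X.cycLength g ≤ (X.reducedSeq g).length := by
  classical
  have h := congrArg List.length
    (FreeGroup.reduceCyclically.conj_conjugator_reduceCyclically (X.reducedSeq g))
  simp only [List.length_append] at h
  rw [cycLength]
  omega

theorem wordLength_inr_mk (X : FBasis F) (g : F) :
    X.wordLength (.inr (ConjClasses.mk g)) = X.cycLength g := by
  have h : IsConj (Quotient.out (ConjClasses.mk g)) g := by
    rw [← ConjClasses.mk_eq_mk_iff_isConj]
    exact Quotient.out_eq _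
  rw [← X.cycLength_eq_of_isConj h]
  rfl

end FBasis

/-! ### Weights of cyclic words -/

namespace PairWeight

open Filter Topology

variable {F : Type*} [Group F]

/-- The mean weight of the pairs `(1, r ^ k)` along an ultrafilter. -/
noncomputable def cyclicFun (r : F) (S : Set (F × F)) : ENNReal :=
  ((hyperfilter ℕ).map fun k : ℕ => (straight (r ^ k)).toFun S / (k : ENNReal)).lim

/-- The extended half-line is compact, so an ultrafilter limit exists for every `S`. This is why an
ultrafilter is used in place of an ordinary limit. -/
theorem tendsto_cyclicFun (r : F) (S : Set (F × F)) :
    Tendsto (fun k : ℕ => (straight (r ^ k)).toFun S / (k : ENNReal)) (hyperfilter ℕ)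
      (𝓝 (cyclicFun r S)) :=
  Ultrafilter.le_nhds_lim _

/-- The asymptotic weight counting the translates of the axis of `r`. -/
noncomputable def cyclic (r : F) : PairWeight F where
  toFun := cyclicFun r
  union' S T h := by
    refine tendsto_nhds_unique (tendsto_cyclicFun r (S ∪ T))
      (((tendsto_cyclicFun r S).add (tendsto_cyclicFun r T)).congr fun k => ?_)
    rw [(straight (r ^ k)).union' S T h, ENNReal.add_div]
  smul' f S := by
    simp only [cyclicFun, (straight _).smul']

/-- Finite sums of weights. -/
noncomputable def sum {ι : Type*} (R : Finset ι) (m : ι → PairWeight F) : PairWeight F where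
  toFun S := ∑ r ∈ R, (m r).toFun S
  union' S T h := by
    rw [← Finset.sum_add_distrib]
    exact Finset.sum_congr rfl fun r _ => (m r).union' S T h
  smul' f S := Finset.sum_congr rfl fun r _ => (m r).smul' f S

/-- The weight computing the lengths of a word. -/
noncomputable def ofWord : FWord F → PairWeight F
  | .inl g => straight g
  | .inr c => cyclic (Quotient.out c)

end PairWeight

/-! ### Heights as cut sums, and connectedness of the graphs -/

namespace FBasis

open Filter Topology PairWeight

variable {F : Type*} [Group F] {X Y : FBasis F} {R : Finset (FWord F)}

theorem IsGlobalMin.isLocalMin (hX : X.IsGlobalMin R) : X.IsLocalMin R := fun X' _ => hX X'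

theorem adj_or_eq_of_isNeighbour (h : X.IsNeighbour Y) : (GammaF F).Adj X Y ∨ X = Y := by
  by_cases hXY : X = Y
  · exact .inr hXY
  · left
    rw [GammaF, SimpleGraph.fromRel_adj]
    exact ⟨hXY, .inl h⟩

/-- Descent to a local minimum. -/
theorem exists_descent (R : Finset (FWord F)) (X : FBasis F) :
    ∃ Y : FBasis F, Y.IsLocalMin R ∧ ∃ p : (GammaF F).Walk X Y, p.support.IsChain
      (fun Z Z' => Z.IsWhiteheadTransform Z' ∧ Z'.height R < Z.height R) := by
  induction hd : X.height R using Nat.strong_induction_on generalizing X with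
  | _ d ih =>
    by_cases hX : X.IsLocalMin R
    · exact ⟨X, hX, .nil, by simp⟩
    · simp only [IsLocalMin, not_forall, not_le] at hX
      obtain ⟨X', hX', hlt⟩ := hX
      obtain ⟨Y, hY, p, hp⟩ := ih _ (hd ▸ hlt) X' rfl
      have hadj : (GammaF F).Adj X X' := by
        rw [GammaF, SimpleGraph.fromRel_adj]
        exact ⟨fun h => (h ▸ hlt).ne rfl, .inl (.inr hX')⟩
      refine ⟨Y, hY, .cons hadj p, ?_⟩
      rw [SimpleGraph.Walk.support_cons]
      cases p with
      | nil => simpa using ⟨hX', hlt⟩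
      | cons h q =>
        rw [SimpleGraph.Walk.support_cons] at hp ⊢
        exact List.IsChain.cons_cons ⟨hX', hlt⟩ hp

/-- The set of elements of an indexed basis. -/
def ofFreeGroupBasis {ι : Type*} (b : FreeGroupBasis ι F) : FBasis F := ⟨Set.range b, by
  have hb : Function.Injective b := b.injective
  have h : FreeGroup.lift (Subtype.val : Set.range b → F) =
      b.repr.symm.toMonoidHom.comp
        (FreeGroup.freeGroupCongr (Equiv.ofInjective b hb).symm).toMonoidHom := by
    ext ⟨_, i, rfl⟩
    simp only [FreeGroup.lift_apply_of, MonoidHom.comp_apply, MulEquiv.coe_toMonoidHom,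
      FreeGroup.freeGroupCongr_apply, FreeGroup.map.of, Equiv.ofInjective_symm_apply]
    rfl
  show Function.Bijective _
  rw [h]
  exact b.repr.symm.bijective.comp (MulEquiv.bijective _)⟩

theorem nonempty_of_isFreeGroup [IsFreeGroup F] : Nonempty (FBasis F) :=
  ⟨ofFreeGroupBasis (IsFreeGroup.basis F)⟩

variable [Group.FG F]

/-- This is the limit of the length formula for `r ^ k` divided by `k`; the sum over the basis is
finite and so commutes with the limit. -/
theorem cutSum_cyclic (X : FBasis F) (r : F) : X.cutSum (cyclic r).cap = X.cycLength r := by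
  have : Fintype X.1 := Fintype.ofFinite _
  have h1 := (X.tendsto_cycLength r).mono_left Nat.hyperfilter_le_atTop
  refine tendsto_nhds_unique ?_ h1
  rw [cutSum, finsum_eq_sum_of_fintype]
  refine (tendsto_finsetSum _ fun x _ => tendsto_cyclicFun r _).congr fun k => ?_
  have h2 := X.cutSum_straight (r ^ k)
  rw [cutSum, finsum_eq_sum_of_fintype] at h2
  rw [← h2]
  simp only [div_eq_mul_inv, Finset.sum_mul]
  rfl

theorem cutSum_ofWord (X : FBasis F) (r : FWord F) :
    X.cutSum (ofWord r).cap = X.wordLength r := by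
  rcases r with g | c
  · exact X.cutSum_straight g
  · exact X.cutSum_cyclic (Quotient.out c)

theorem cutSum_height (R : Finset (FWord F)) (X : FBasis F) :
    X.cutSum (PairWeight.sum R ofWord).cap = X.height R := by
  have : Fintype X.1 := Fintype.ofFinite _
  rw [height, Nat.cast_sum, ← Finset.sum_congr rfl fun r _ => X.cutSum_ofWord r]
  simp only [cutSum, finsum_eq_sum_of_fintype]
  exact Finset.sum_comm

theorem height_eq_of_signed_eq (h : Y.signed = X.signed) : Y.height R = X.height R := by
  have := cutSum_congr h (PairWeight.sum R ofWord).cap_smul (PairWeight.sum R ofWord).cap_compl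
  rw [cutSum_height, cutSum_height] at this
  exact_mod_cast this

/-- One step of the approach to a local minimum. -/
theorem exists_step (hX : X.IsLocalMin R) (Y : FBasis F) :
    Y.signed = X.signed ∨ ∃ Y' : FBasis F, Y.IsWhiteheadTransform Y' ∧
      Y'.height R ≤ Y.height R ∧ Y'.cutSum X.crossing < Y.cutSum X.crossing := by
  by_cases hne : Y.halves ⊆ X.halves
  · exact .inl (signed_eq_of_halves_subset hne)
  · right
    obtain ⟨Y', h1, h2, h3⟩ := exists_transform_le (PairWeight.sum R ofWord)
      (by rw [cutSum_height]; exact ENNReal.natCast_ne_top _)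
      (by rw [cutSum_height]; exact ENNReal.natCast_ne_top _)
      (fun X' hX' => by
        rw [cutSum_height, cutSum_height]
        exact_mod_cast hX X' hX') hne
    rw [cutSum_height, cutSum_height] at h2
    exact ⟨Y', h1, by exact_mod_cast h2, h3⟩

/-- Local minima are global minima. -/
theorem IsLocalMin.isGlobalMin (hX : X.IsLocalMin R) : X.IsGlobalMin R := by
  intro Y
  induction hd : Y.cutSum X.crossing using Nat.strong_induction_on generalizing Y with
  | _ d ih =>
    rcases exists_step hX Y with h | ⟨Y', h1, h2, h3⟩
    · exact (height_eq_of_signed_eq h).ge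
    · exact (ih _ (hd ▸ h3) Y' rfl).trans h2

theorem IsLocalMin.height_eq (hX : X.IsLocalMin R) (hY : Y.IsLocalMin R) :
    X.height R = Y.height R :=
  (hX.isGlobalMin Y).antisymm (hY.isGlobalMin X)

/-- Steps towards `X` do not raise the height and `Y` is already a global minimum, so every basis on
the way is a global, hence local, minimum. -/
theorem reachable_of_isLocalMin (hX : X.IsLocalMin R) (hY : Y.IsLocalMin R) :
    (GammaH R).Reachable ⟨Y, hY⟩ ⟨X, hX⟩ := by
  induction hd : Y.cutSum X.crossing using Nat.strong_induction_on generalizing Y with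
  | _ d ih =>
    have key : ∀ {Z Z' : FBasis F} (hZ : Z.IsLocalMin R) (hZ' : Z'.IsLocalMin R),
        Z.IsNeighbour Z' → (GammaH R).Reachable ⟨Z, hZ⟩ ⟨Z', hZ'⟩ := by
      intro Z Z' hZ hZ' h
      rcases adj_or_eq_of_isNeighbour h with h | rfl
      · exact SimpleGraph.Adj.reachable h
      · exact SimpleGraph.Reachable.refl _
    rcases exists_step hX Y with h | ⟨Y', h1, h2, h3⟩
    · exact key hY hX (.inl h.symm)
    · have hY' : Y'.IsLocalMin R :=
        IsGlobalMin.isLocalMin fun Z => h2.trans (hY.isGlobalMin Z)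
      exact (key hY hY' (.inr h1)).trans (ih _ (hd ▸ h3) hY' rfl)

theorem connected_gammaH [IsFreeGroup F] (R : Finset (FWord F)) : (GammaH R).Connected := by
  obtain ⟨X⟩ := nonempty_of_isFreeGroup (F := F)
  obtain ⟨Y, hY, -⟩ := exists_descent R X
  rw [SimpleGraph.connected_iff]
  exact ⟨fun A B => reachable_of_isLocalMin B.2 A.2, ⟨⟨Y, hY⟩⟩⟩

/-- Without words the height is zero, so every basis is a local minimum. -/
theorem connected_gammaF [IsFreeGroup F] : (GammaF F).Connected := by
  have h := connected_gammaH (∅ : Finset (FWord F))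
  have hmin : ∀ X : FBasis F, X.IsLocalMin ∅ := fun X X' _ => by simp [height]
  rw [SimpleGraph.connected_iff]
  refine ⟨fun A B => ?_, ⟨h.nonempty.some.1⟩⟩
  exact (h.preconnected ⟨A, hmin A⟩ ⟨B, hmin B⟩).map
    (SimpleGraph.Embedding.induce _).toHom

/-- Bases of bounded height are connected through bases of bounded height. -/
theorem reachable_induce_height (R : Finset (FWord F)) (N : ℕ)
    (A B : {X : FBasis F | X.height R ≤ N}) :
    ((GammaF F).induce {X : FBasis F | X.height R ≤ N}).Reachable A B := by
  set G := (GammaF F).induce {X : FBasis F | X.height R ≤ N} with hG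
  have key : ∀ A : {X : FBasis F | X.height R ≤ N}, ∃ Y, ∃ hY : Y.1.IsLocalMin R,
      G.Reachable A Y := by
    rintro ⟨A, hA⟩
    induction hd : A.height R using Nat.strong_induction_on generalizing A with
    | _ d ih =>
      by_cases hAm : A.IsLocalMin R
      · exact ⟨⟨A, hA⟩, hAm, .refl _⟩
      · simp only [IsLocalMin, not_forall, not_le] at hAm
        obtain ⟨A', hA', hlt⟩ := hAm
        obtain ⟨Y, hY, h⟩ := ih _ (hd ▸ hlt) A' (hlt.le.trans hA) rfl
        refine ⟨Y, hY, SimpleGraph.Reachable.trans (SimpleGraph.Adj.reachable ?_) h⟩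
        rw [hG, SimpleGraph.comap_adj]
        change (GammaF F).Adj A A'
        rw [GammaF, SimpleGraph.fromRel_adj]
        exact ⟨fun h => (h ▸ hlt).ne rfl, .inl (.inr hA')⟩
  obtain ⟨Y, hY, h1⟩ := key A
  obtain ⟨Z, hZ, h2⟩ := key B
  have h3 := reachable_of_isLocalMin hZ hY
  -- All local minima share one height, which is at most `N` because `Y` has it.
  have hle : {X : FBasis F | X.IsLocalMin R} ⊆ {X : FBasis F | X.height R ≤ N} :=
    fun X hX => (hX.height_eq hY).trans_le Y.2
  exact (h1.trans (h3.map (SimpleGraph.induceHomOfLE (GammaF F) hle).toHom)).trans h2.symm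

end FBasis

/-! ### Conjugation through short words -/

namespace FreeGroup

variable {α : Type*} [DecidableEq α]

theorem IsReduced.invRev {L : List (α × Bool)} (h : IsReduced L) :
    IsReduced (FreeGroup.invRev L) := by
  rw [isReduced_iff_reduce_eq] at h ⊢
  rw [reduce_invRev, h]

/-- If conjugating by a letter makes a word longer, then no cancellation occurs. -/
theorem isReduced_of_norm_lt_norm_conj {u : FreeGroup α} {x : α × Bool}
    (h : u.norm < (mk [x] * u * (mk [x])⁻¹).norm) :
    IsReduced ([x] ++ u.toWord ++ FreeGroup.invRev [x]) := by
  rw [isReduced_iff_reduce_eq]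
  have h1 : mk [x] * u * (mk [x])⁻¹ = mk ([x] ++ u.toWord ++ FreeGroup.invRev [x]) := by
    rw [← mul_mk, ← mul_mk, mk_toWord, inv_mk]
  rw [h1, norm, norm, toWord_mk] at h
  have hred : Red ([x] ++ u.toWord ++ FreeGroup.invRev [x]) _ := reduce.red
  -- Reduction removes letters in pairs. The word has two letters more than `u`, so staying longer
  -- than `u` means that nothing is removed.
  obtain ⟨k, hk⟩ := hred.length
  refine hred.sublist.eq_of_length ?_
  have h2 : ([x] ++ u.toWord ++ FreeGroup.invRev [x]).length = u.toWord.length + 2 := by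
    simp [FreeGroup.invRev]
  omega

/-- Conjugate short words are joined by a path of conjugations by letters through
short words. -/
theorem reflTransGen_conj (M : ℕ) (w : List (α × Bool)) (hw : IsReduced w) (u : FreeGroup α)
    (hu : u.norm ≤ M) (hv : (mk w * u * (mk w)⁻¹).norm ≤ M) :
    Relation.ReflTransGen (fun p q : FreeGroup α => p.norm ≤ M ∧ q.norm ≤ M ∧
      ∃ x : α × Bool, q = mk [x] * p * (mk [x])⁻¹) u (mk w * u * (mk w)⁻¹) := by
  induction w using List.reverseRecOn generalizing u with
  | nil =>
    have : mk ([] : List (α × Bool)) = 1 := rfl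
    simpa [this] using Relation.ReflTransGen.refl
  | append_singleton w x ih =>
    have e : mk (w ++ [x]) * u * (mk (w ++ [x]))⁻¹ =
        mk w * (mk [x] * u * (mk [x])⁻¹) * (mk w)⁻¹ := by
      rw [← mul_mk]; group
    rw [e] at hv ⊢
    by_cases h1 : (mk [x] * u * (mk [x])⁻¹).norm ≤ M
    · exact .head ⟨hu, h1, x, rfl⟩ (ih (hw.infix ⟨[], [x], by simp⟩) _ h1 hv)
    -- If the first conjugation overshoots `M`, it lengthens `u` without cancellation. As `w ++ [x]`
    -- is reduced, the whole conjugate is then reduced and at least as long, contradicting `hv`.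
    · exfalso
      have h2 := isReduced_of_norm_lt_norm_conj (hu.trans_lt (not_le.1 h1))
      have h3 : IsReduced (FreeGroup.invRev [x] ++ FreeGroup.invRev w) := by
        have := hw.invRev
        rwa [FreeGroup.invRev_append] at this
      have h4 : IsReduced (w ++ [x] ++ (u.toWord ++ FreeGroup.invRev [x])) :=
        IsReduced.append_overlap hw (by simpa using h2) (by simp)
      have h5 : IsReduced ((w ++ [x] ++ u.toWord) ++ FreeGroup.invRev [x] ++
          FreeGroup.invRev w) :=
        IsReduced.append_overlap (by simpa using h4) h3 (by simp [FreeGroup.invRev])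
      have h6 : mk w * (mk [x] * u * (mk [x])⁻¹) * (mk w)⁻¹ =
          mk ((w ++ [x] ++ u.toWord) ++ FreeGroup.invRev [x] ++ FreeGroup.invRev w) := by
        simp only [← mul_mk, mk_toWord, inv_mk]
        simp only [mul_assoc]
      have h7 : (mk [x] * u * (mk [x])⁻¹).norm ≤ u.norm + 2 := by
        have h8 := norm_mul_le (mk [x] * u) (mk [x])⁻¹
        have h9 := norm_mul_le (mk [x]) u
        have h10 : (mk [x]).norm ≤ 1 := norm_mk_le
        rw [norm_inv_eq] at h8
        omega
      rw [h6, norm, toWord_mk, h5.reduce_eq] at hv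
      simp only [List.length_append, FreeGroup.invRev_length, List.length_cons,
        List.length_nil] at hv
      have h8 : u.toWord.length = u.norm := rfl
      omega

end FreeGroup

/-! ### Reachability in a bounded number of steps -/

/-- The elements reached from `a` in exactly `k` steps. -/
def reachIn {α : Type*} (r : α → α → Prop) (a : α) : ℕ → Set α
  | 0 => {a}
  | k + 1 => {y | ∃ x ∈ reachIn r a k, r x y}

/-- Reflexivity makes the exact-step sets increase. Once two consecutive sets agree they stay
constant, and inside `Q` this happens within `Q.ncard` steps. -/
theorem mem_reachIn_of_reflTransGen {α : Type*} {r : α → α → Prop} {Q : Set α} (hQ : Q.Finite)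
    (hrefl : ∀ x ∈ Q, r x x) (hr : ∀ x y, r x y → y ∈ Q) {a c : α} (ha : a ∈ Q)
    (h : Relation.ReflTransGen r a c) {n : ℕ} (hn : Q.ncard ≤ n) : c ∈ reachIn r a n := by
  have hsub : ∀ k, reachIn r a k ⊆ Q := by
    intro k
    cases k with
    | zero => rintro x rfl; exact ha
    | succ k => rintro x ⟨y, -, h⟩; exact hr _ _ h
  have hstep : ∀ k, reachIn r a k ⊆ reachIn r a (k + 1) :=
    fun k x hx => ⟨x, hx, hrefl x (hsub k hx)⟩
  have hmono : Monotone (reachIn r a) := monotone_nat_of_le_succ hstep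
  have hfin : ∀ k, (reachIn r a k).Finite := fun k => hQ.subset (hsub k)
  have hstab : ∀ m, Q.ncard ≤ m → reachIn r a m = reachIn r a Q.ncard := by
    intro m hm
    refine (Set.eq_of_subset_of_ncard_le (hmono hm) (le_of_eq ?_) (hfin m)).symm
    refine Nat.stabilises_of_monotone (f := fun k => (reachIn r a k).ncard)
      (fun i j hij => Set.ncard_le_ncard (hmono hij) (hfin j))
      (fun k => Set.ncard_le_ncard (hsub k) hQ) (fun k hk => ?_) hm
    have := Set.eq_of_subset_of_ncard_le (hstep k) hk.ge (hfin _)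
    have h2 : reachIn r a (k + 1) = reachIn r a (k + 2) := by
      rw [reachIn, reachIn, ← this]
    simp only [h2]
  have : ∃ k, c ∈ reachIn r a k := by
    induction h with
    | refl => exact ⟨0, rfl⟩
    | tail _ h ih =>
      obtain ⟨k, hk⟩ := ih
      exact ⟨k + 1, _, hk, h⟩
  obtain ⟨k, hk⟩ := this
  rw [hstab n hn, ← hstab _ (le_max_left Q.ncard k)]
  exact hmono (le_max_right _ _) hk

/-! ### Equivariance of lengths and neighbours -/

namespace FWord

variable {F : Type*} [Group F]

theorem map_trans (e e' : F ≃* F) (r : FWord F) :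
    FWord.map (e.trans e') r = FWord.map e' (FWord.map e r) := by
  rcases r with g | c
  · rfl
  · induction c using Quotient.inductionOn
    rfl

theorem map_symm_map (e : F ≃* F) (r : FWord F) : FWord.map e.symm (FWord.map e r) = r := by
  rcases r with g | c
  · simp [FWord.map]
  · induction c using Quotient.inductionOn
    exact congrArg (fun g => Sum.inr (ConjClasses.mk g)) (e.symm_apply_apply _)

end FWord

namespace FBasis

variable {F : Type*} [Group F] {X Y : FBasis F}

open Filter Topology

theorem map_trans (X : FBasis F) (e e' : F ≃* F) : X.map (e.trans e') = (X.map e).map e' :=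
  Subtype.ext (by simp [Set.image_image])

theorem map_refl (X : FBasis F) : X.map (MulEquiv.refl F) = X :=
  Subtype.ext (by simp)

theorem map_map_symm (X : FBasis F) (e : F ≃* F) : (X.map e).map e.symm = X := by
  rw [← map_trans, MulEquiv.self_trans_symm, map_refl]

theorem map_symm_map (X : FBasis F) (e : F ≃* F) : (X.map e.symm).map e = X := by
  rw [← map_trans, MulEquiv.symm_trans_self, map_refl]

theorem IsNeighbour.map (h : X.IsNeighbour Y) (e : F ≃* F) :
    (X.map e).IsNeighbour (Y.map e) := by
  rcases h with h | ⟨x, hx, h⟩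
  · left
    rw [signed_map, signed_map, h]
  · right
    refine ⟨e x, by rw [signed_map]; exact ⟨x, hx, rfl⟩, ?_⟩
    have h1 := Set.image_mono (f := e) h
    simpa [Set.image_mul, Set.image_pair] using h1

theorem length_reducedSeq_prod_le (X : FBasis F) (L : List F) (hL : ∀ a ∈ L, a ∈ X.signed) :
    (X.reducedSeq L.prod).length ≤ L.length := by
  classical
  induction L with
  | nil => simp [reducedSeq_one]
  | cons a L ih =>
    rw [List.prod_cons, List.length_cons]
    have h1 := X.length_reducedSeq_mul_le a L.prod
    have h2 := ih fun b hb => hL b (List.mem_cons_of_mem _ hb)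
    obtain ⟨l, hl⟩ := X.mem_signed_iff.1 (hL a (by simp))
    have h3 : (X.reducedSeq a).length ≤ 1 := by
      rw [← hl, reducedSeq, equiv_symm_letter]
      exact FreeGroup.norm_mk_le
    omega

theorem prod_map_letter (X : FBasis F) (L : List (X.1 × Bool)) :
    (L.map X.letter).prod = X.equiv (FreeGroup.mk L) := by
  induction L with
  | nil => exact (map_one X.equiv).symm
  | cons l L ih =>
    rw [List.map_cons, List.prod_cons, ih, show l :: L = [l] ++ L from rfl, ← FreeGroup.mul_mk,
      map_mul, ← equiv_symm_letter, MulEquiv.apply_symm_apply]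

theorem prod_map_letter_reducedSeq (X : FBasis F) (g : F) :
    ((X.reducedSeq g).map X.letter).prod = g := by
  classical
  rw [prod_map_letter, reducedSeq, FreeGroup.mk_toWord, MulEquiv.apply_symm_apply]

theorem length_reducedSeq_map_le (X : FBasis F) (e : F ≃* F) (g : F) :
    ((X.map e).reducedSeq (e g)).length ≤ (X.reducedSeq g).length := by
  have h := (X.map e).length_reducedSeq_prod_le (((X.reducedSeq g).map X.letter).map e) (by
    intro a ha
    simp only [List.mem_map] at ha
    obtain ⟨_, ⟨l, -, rfl⟩, rfl⟩ := ha
    rw [signed_map]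
    exact ⟨_, X.letter_mem_signed l, rfl⟩)
  rw [← map_list_prod, prod_map_letter_reducedSeq] at h
  simpa using h

theorem length_reducedSeq_map (X : FBasis F) (e : F ≃* F) (g : F) :
    ((X.map e).reducedSeq (e g)).length = (X.reducedSeq g).length := by
  refine le_antisymm (X.length_reducedSeq_map_le e g) ?_
  have := (X.map e).length_reducedSeq_map_le e.symm (e g)
  rwa [map_map_symm, MulEquiv.symm_apply_apply] at this

theorem cycLength_map (X : FBasis F) (e : F ≃* F) (g : F) :
    (X.map e).cycLength (e g) = X.cycLength g := by
  have h := (X.map e).tendsto_cycLength (e g)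
  simp only [← map_pow, length_reducedSeq_map] at h
  exact_mod_cast tendsto_nhds_unique h (X.tendsto_cycLength g)

theorem wordLength_map (X : FBasis F) (e : F ≃* F) (r : FWord F) :
    (X.map e).wordLength (FWord.map e r) = X.wordLength r := by
  rcases r with g | c
  · exact X.length_reducedSeq_map e g
  · induction c using Quotient.inductionOn with
    | h g =>
      change _ = X.wordLength (.inr (ConjClasses.mk g))
      rw [wordLength_inr_mk, ← X.cycLength_map e g, ← wordLength_inr_mk]
      rfl

/-- A cyclic word is represented by an element whose length is the length of the word. -/
theorem exists_mk_length_le (X : FBasis F) (c : ConjClasses F) :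
    ∃ g, ConjClasses.mk g = c ∧ (X.reducedSeq g).length ≤ X.wordLength (.inr c) := by
  classical
  let L := X.reducedSeq (Quotient.out c)
  let u := FreeGroup.mk (FreeGroup.reduceCyclically.conjugator L)
  let s := FreeGroup.mk (FreeGroup.reduceCyclically L)
  have h : u * s * u⁻¹ = X.equiv.symm (Quotient.out c) := by
    have h1 := congrArg FreeGroup.mk (FreeGroup.reduceCyclically.conj_conjugator_reduceCyclically L)
    rw [← FreeGroup.mul_mk, ← FreeGroup.mul_mk, ← FreeGroup.inv_mk] at h1
    rw [show u * s * u⁻¹ = FreeGroup.mk L from h1]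
    exact FreeGroup.mk_toWord
  refine ⟨X.equiv s, ?_, ?_⟩
  · have h2 : ConjClasses.mk (Quotient.out c) = c := Quotient.out_eq c
    rw [← h2, ConjClasses.mk_eq_mk_iff_isConj, isConj_iff]
    refine ⟨X.equiv u, ?_⟩
    rw [← map_mul, ← map_inv, ← map_mul, h, MulEquiv.apply_symm_apply]
  · rw [reducedSeq, MulEquiv.symm_apply_apply]
    exact FreeGroup.norm_mk_le

/-- An automorphism is determined by its values on the finite set `E`, and for a neighbour these lie
in a fixed finite set. -/
theorem finite_setOf_isNeighbour_map [Group.FG F] (E : FBasis F) :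
    {e : F ≃* F | E.IsNeighbour (E.map e)}.Finite := by
  let D : Set F := E.signed ∪ ⋃ x ∈ E.signed, ({1, x} : Set F) * E.1 * ({1, x⁻¹} : Set F)
  have hD : D.Finite := E.finite_signed.union (E.finite_signed.biUnion fun x _ =>
    ((Set.toFinite _).mul (Set.toFinite _)).mul (Set.toFinite _))
  have hpi : {f : E.1 → F | ∀ x, f x ∈ D}.Finite := by
    have := Set.Finite.pi' fun _ : E.1 => hD
    simpa using this
  refine Set.Finite.of_injOn (f := fun (e : F ≃* F) (x : E.1) => e x)
    (t := {f : E.1 → F | ∀ x, f x ∈ D}) ?_ ?_ hpi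
  · rintro e he x
    have hx : e x ∈ (E.map e).1 := ⟨x, x.2, rfl⟩
    rcases he with he | ⟨y, hy, he⟩
    · exact .inl (he ▸ (E.map e).mem_signed_of_mem hx)
    · exact .inr (Set.mem_biUnion hy (he hx))
  · intro e _ e' _ h
    have : e.toMonoidHom = e'.toMonoidHom := E.hom_ext fun x hx => congrFun h ⟨x, hx⟩
    ext g
    exact DFunLike.congr_fun this g

end FBasis

/-! ### Coded words and moves between them -/

namespace WordCode

open FBasis

variable {F : Type*} [Group F] {n : ℕ} (b : FreeGroupBasis (Fin n) F)

/-- The reduced sequence of letters of an element. -/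
def code (g : F) : List (Fin n × Bool) := (b.repr g).toWord

@[simp] theorem spell_code (g : F) : spell b (code b g) = g := by
  rw [spell, code, FreeGroup.mk_toWord, MulEquiv.symm_apply_apply]

theorem code_spell (l : List (Fin n × Bool)) : code b (spell b l) = FreeGroup.reduce l := by
  rw [spell, code, MulEquiv.apply_symm_apply, FreeGroup.toWord_mk]

theorem reduce_code (g : F) : FreeGroup.reduce (code b g) = code b g :=
  FreeGroup.reduce_toWord _

theorem spell_append (l l' : List (Fin n × Bool)) :
    spell b (l ++ l') = spell b l * spell b l' := by
  rw [spell, spell, spell, ← FreeGroup.mul_mk, map_mul]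

theorem spell_nil : spell b [] = 1 := map_one b.repr.symm

theorem spell_false (i : Fin n) : spell b [(i, false)] = (b i)⁻¹ :=
  map_inv b.repr.symm (FreeGroup.of i)

theorem spell_singleton_mem_signed (x : Fin n × Bool) :
    spell b [x] ∈ (ofFreeGroupBasis b).signed := by
  obtain ⟨i, _ | _⟩ := x
  · right
    exact ⟨i, by rw [spell_false, inv_inv]⟩
  · left
    exact ⟨i, rfl⟩

theorem spell_eq_prod (l : List (Fin n × Bool)) :
    spell b l = (l.map fun x => spell b [x]).prod := by
  induction l with
  | nil => exact spell_nil b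
  | cons x l ih => rw [List.map_cons, List.prod_cons, ← ih, ← spell_append]; rfl

theorem length_spell_le (l : List (Fin n × Bool)) :
    ((ofFreeGroupBasis b).reducedSeq (spell b l)).length ≤ l.length := by
  rw [spell_eq_prod]
  refine ((ofFreeGroupBasis b).length_reducedSeq_prod_le _ ?_).trans_eq (by simp)
  intro a ha
  obtain ⟨x, -, rfl⟩ := List.mem_map.1 ha
  exact spell_singleton_mem_signed b x

theorem length_code_spell_le (l : List (Fin n × Bool)) :
    (code b (spell b l)).length ≤ l.length := by
  rw [code_spell]
  exact FreeGroup.norm_mk_le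

theorem length_code_le (g : F) :
    (code b g).length ≤ ((ofFreeGroupBasis b).reducedSeq g).length := by
  have h : ∀ x : (ofFreeGroupBasis b).1 × Bool, ∃ y : Fin n × Bool,
      spell b [y] = (ofFreeGroupBasis b).letter x := by
    rintro ⟨⟨_, i, rfl⟩, _ | _⟩
    · exact ⟨(i, false), spell_false b i⟩
    · exact ⟨(i, true), rfl⟩
  choose f hf using h
  have h2 : spell b (((ofFreeGroupBasis b).reducedSeq g).map f) = g := by
    rw [spell_eq_prod, List.map_map]
    conv_rhs => rw [← (ofFreeGroupBasis b).prod_map_letter_reducedSeq g]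
    congr 1
    exact List.map_congr_left fun x _ => hf x
  have h3 := length_code_spell_le b (((ofFreeGroupBasis b).reducedSeq g).map f)
  rwa [h2, List.length_map] at h3

/-- The sequence of letters underlying a code. -/
def letters : WordCode n → List (Fin n × Bool) := Sum.elim id id

/-- The reduction of a code. -/
def reduced : WordCode n → WordCode n := Sum.map FreeGroup.reduce FreeGroup.reduce

/-- A code is short if it is reduced and has length at most `M`. -/
def Short (M : ℕ) (c : WordCode n) : Prop := reduced c = c ∧ (letters c).length ≤ M

theorem spell_reduce (l : List (Fin n × Bool)) : spell b (FreeGroup.reduce l) = spell b l := by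
  rw [spell, spell, FreeGroup.reduce.self]

theorem decode_reduced (c : WordCode n) : decode b (reduced c) = decode b c := by
  rcases c with l | l <;> simp [decode, reduced, spell_reduce]

theorem short_reduced {M : ℕ} {c : WordCode n} (h : (letters c).length ≤ M) :
    Short M (reduced c) := by
  have key : ∀ l : List (Fin n × Bool), (FreeGroup.reduce l).length ≤ l.length :=
    fun l => FreeGroup.norm_mk_le (L₁ := l)
  rcases c with l | l
  · exact ⟨by simp [reduced, FreeGroup.reduce.idem], (key l).trans h⟩
  · exact ⟨by simp [reduced, FreeGroup.reduce.idem], (key l).trans h⟩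

theorem Short.mono {M M' : ℕ} {c : WordCode n} (h : Short M c) (hM : M ≤ M') : Short M' c :=
  ⟨h.1, h.2.trans hM⟩

/-- The elements used to conjugate cyclic words. -/
noncomputable def conjugators : List F :=
  1 :: (Finset.univ : Finset (Fin n × Bool)).toList.map fun x => spell b [x]

/-- The codes of the image of a word, up to conjugation by a letter in the case of a
cyclic word. -/
noncomputable def choices (e : F ≃* F) : WordCode n → List (WordCode n)
  | .inl l => [.inl (code b (e (spell b l)))]
  | .inr l => (conjugators b).map fun g => .inr (code b (g * e (spell b l) * g⁻¹))

variable {b}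

theorem decode_of_mem_choices {e : F ≃* F} {c c' : WordCode n} (h : c' ∈ choices b e c) :
    decode b c' = FWord.map e (decode b c) := by
  rcases c with l | l
  · obtain rfl := List.mem_singleton.1 h
    simp [decode, FWord.map]
  · obtain ⟨g, -, rfl⟩ := List.mem_map.1 h
    have : ConjClasses.mk (g * e (spell b l) * g⁻¹) = ConjClasses.mk (e (spell b l)) := by
      rw [ConjClasses.mk_eq_mk_iff_isConj, isConj_comm, isConj_iff]
      exact ⟨g, rfl⟩
    simp only [decode, Sum.map_inr, spell_code, FWord.map, this]
    rfl

theorem reduced_of_mem_choices {e : F ≃* F} {c c' : WordCode n} (h : c' ∈ choices b e c) :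
    reduced c' = c' := by
  rcases c with l | l
  · obtain rfl := List.mem_singleton.1 h
    simp [reduced, reduce_code]
  · obtain ⟨g, -, rfl⟩ := List.mem_map.1 h
    simp [reduced, reduce_code]

variable (b)

/-- The code of the image of a coded word. -/
def act (e : F ≃* F) : WordCode n → WordCode n :=
  Sum.map (fun l => code b (e (spell b l))) fun l => code b (e (spell b l))

theorem act_mem_choices (e : F ≃* F) (c : WordCode n) : act b e c ∈ choices b e c := by
  rcases c with l | l
  · simp [act, choices]
  · simp [act, choices, conjugators]

theorem act_refl {c : WordCode n} (h : reduced c = c) : act b (MulEquiv.refl F) c = c := by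
  rcases c with l | l
  · simpa [act, code_spell, reduced] using h
  · simpa [act, code_spell, reduced] using h

theorem map_spell (e : F ≃* F) (l : List (Fin n × Bool)) :
    e (spell b l) = spell b (l.flatMap fun x => code b (e (spell b [x]))) := by
  induction l with
  | nil => simp [spell_nil]
  | cons x l ih =>
    rw [show x :: l = [x] ++ l from rfl, spell_append, map_mul, ih, List.flatMap_append,
      spell_append]
    simp

theorem exists_forall_length_act_le (W : Set (F ≃* F)) (hW : W.Finite) :
    ∃ C, 1 ≤ C ∧ ∀ e ∈ W, ∀ c : WordCode n,
      (letters (act b e c)).length ≤ C * (letters c).length := by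
  obtain ⟨C, hC⟩ : ∃ C, ∀ e ∈ W, ∀ x, (code b (e (spell b [x]))).length ≤ C := by
    have hfin : (⋃ e ∈ W, Set.range fun x => (code b (e (spell b [x]))).length).Finite :=
      hW.biUnion fun e _ => Set.finite_range _
    obtain ⟨C, hC⟩ := hfin.bddAbove
    exact ⟨C, fun e he x => hC (Set.mem_biUnion he ⟨x, rfl⟩)⟩
  -- `C` bounds the codes of images of single letters; the `+ 1` secures `1 ≤ C`.
  refine ⟨C + 1, by omega, fun e he c => ?_⟩
  have key : ∀ l : List (Fin n × Bool), (code b (e (spell b l))).length ≤ (C + 1) * l.length := by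
    intro l
    rw [map_spell]
    refine (length_code_spell_le b _).trans ?_
    rw [List.length_flatMap]
    refine (List.sum_le_card_nsmul _ (C + 1) ?_).trans_eq (by simp [mul_comm])
    intro m hm
    obtain ⟨x, -, rfl⟩ := List.mem_map.1 hm
    exact (hC e he x).trans (by omega)
  rcases c with l | l
  exacts [key l, key l]

/-- A move between finite sequences of short codes. -/
def Move (W : Set (F ≃* F)) (M : ℕ) (T T' : List (WordCode n)) : Prop :=
  (∀ c ∈ T, Short M c) ∧ (∀ c ∈ T', Short M c) ∧
    ∃ e ∈ W, List.Forall₂ (fun c' c => c' ∈ choices b e c) T' T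

theorem Move.mono {W W' : Set (F ≃* F)} (hW : W ⊆ W') {M : ℕ} {T T' : List (WordCode n)}
    (h : Move b W M T T') : Move b W' M T T' := by
  obtain ⟨h1, h2, e, he, h3⟩ := h
  exact ⟨h1, h2, e, hW he, h3⟩

theorem forall₂_choices_refl {M : ℕ} {T : List (WordCode n)} (h : ∀ c ∈ T, Short M c) :
    List.Forall₂ (fun c' c => c' ∈ choices b (MulEquiv.refl F) c) T T := by
  rw [List.forall₂_same]
  intro c hc
  have := act_mem_choices b (MulEquiv.refl F) c
  rwa [act_refl b (h c hc).1] at this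

/-- A reduced code of a straight word is unique. Codes of a cyclic word are conjugate, and
`FreeGroup.reflTransGen_conj` joins them by letters without exceeding length `M`. -/
theorem reflTransGen_move_single {M : ℕ} {c c' : WordCode n} (h : Short M c) (h' : Short M c')
    (hd : decode b c = decode b c') :
    Relation.ReflTransGen (fun c c' : WordCode n => Short M c ∧ Short M c' ∧
      c' ∈ choices b (MulEquiv.refl F) c) c c' := by
  rcases c with l | l <;> rcases c' with l' | l'
  · have h1 : spell b l = spell b l' := Sum.inl.inj hd
    have h2 := congrArg (code b) h1
    rw [code_spell, code_spell, Sum.inl.inj h.1, Sum.inl.inj h'.1] at h2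
    rw [h2]
  · cases hd
  · cases hd
  · have h1 : ConjClasses.mk (spell b l) = ConjClasses.mk (spell b l') := Sum.inr.inj hd
    rw [ConjClasses.mk_eq_mk_iff_isConj, isConj_iff] at h1
    obtain ⟨g, hg⟩ := h1
    have hl : (FreeGroup.mk l).toWord = l := Sum.inr.inj h.1
    have hl' : (FreeGroup.mk l').toWord = l' := Sum.inr.inj h'.1
    have hg' : FreeGroup.mk (code b g) * FreeGroup.mk l * (FreeGroup.mk (code b g))⁻¹ =
        FreeGroup.mk l' := by
      apply b.repr.symm.injective
      simp only [map_mul, map_inv]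
      change spell b (code b g) * spell b l * (spell b (code b g))⁻¹ = spell b l'
      rw [spell_code, hg]
    have h2 := FreeGroup.reflTransGen_conj M (code b g) FreeGroup.isReduced_toWord
      (FreeGroup.mk l) (by rw [FreeGroup.norm, hl]; exact h.2)
      (by rw [hg', FreeGroup.norm, hl']; exact h'.2)
    rw [hg'] at h2
    have h3 : Relation.ReflTransGen (fun c c' : WordCode n => Short M c ∧ Short M c' ∧
        c' ∈ choices b (MulEquiv.refl F) c) (.inr (FreeGroup.mk l).toWord)
        (.inr (FreeGroup.mk l').toWord) := by
      refine Relation.ReflTransGen.lift (fun p => (Sum.inr p.toWord : WordCode n)) ?_ _ _ h2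
      rintro p _ ⟨hp, hq, x, rfl⟩
      refine ⟨⟨by simp [reduced], hp⟩, ⟨by simp [reduced], hq⟩, ?_⟩
      refine List.mem_map.2 ⟨spell b [x], ?_, ?_⟩
      · exact List.mem_cons_of_mem _ (List.mem_map.2 ⟨x, by simp, rfl⟩)
      · simp [code, spell, FreeGroup.mk_toWord]
    rwa [hl, hl'] at h3

/-- Short sequences of codes of the same words are joined by moves. -/
theorem reflTransGen_move_of_decode_eq {M : ℕ} {T T' : List (WordCode n)}
    (h : ∀ c ∈ T, Short M c) (h' : ∀ c ∈ T', Short M c)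
    (hd : T.map (decode b) = T'.map (decode b)) :
    Relation.ReflTransGen (Move b {MulEquiv.refl F} M) T T' := by
  induction T generalizing T' with
  | nil =>
    obtain rfl := List.map_eq_nil_iff.1 hd.symm
    rfl
  | cons c T ih =>
    rcases T' with _ | ⟨c', T'⟩
    · simp at hd
    · simp only [List.map_cons, List.cons.injEq] at hd
      simp only [List.forall_mem_cons] at h h'
      refine Relation.ReflTransGen.trans (b := c' :: T) ?_ ?_
      · refine (reflTransGen_move_single b h.1 h'.1 hd.1).lift (fun c => c :: T) ?_
        rintro a a' ⟨h1, h2, h3⟩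
        refine ⟨?_, ?_, _, rfl, .cons h3 (forall₂_choices_refl b h.2)⟩
        · exact List.forall_mem_cons.2 ⟨h1, h.2⟩
        · exact List.forall_mem_cons.2 ⟨h2, h.2⟩
      · refine (ih h.2 h'.2 hd.2).lift (fun T => c' :: T) ?_
        rintro U U' ⟨h1, h2, e, rfl, h3⟩
        refine ⟨?_, ?_, _, rfl, .cons ?_ h3⟩
        · exact List.forall_mem_cons.2 ⟨h'.1, h1⟩
        · exact List.forall_mem_cons.2 ⟨h'.1, h2⟩
        · have := act_mem_choices b (MulEquiv.refl F) c'
          rwa [act_refl b h'.1.1] at this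

theorem exists_short_of_wordLength_le {N : ℕ} {r : FWord F}
    (h : (ofFreeGroupBasis b).wordLength r ≤ N) : ∃ c : WordCode n, Short N c ∧ decode b c = r := by
  rcases r with g | c
  · refine ⟨.inl (code b g), ⟨by simp [reduced, reduce_code], (length_code_le b g).trans h⟩, ?_⟩
    simp [decode]
  · obtain ⟨g, rfl, hg⟩ := (ofFreeGroupBasis b).exists_mk_length_le c
    refine ⟨.inr (code b g), ⟨by simp [reduced, reduce_code],
      (length_code_le b g).trans (hg.trans h)⟩, ?_⟩
    simp [decode]

theorem wordLength_decode_le (c : WordCode n) :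
    (ofFreeGroupBasis b).wordLength (decode b c) ≤ (letters c).length := by
  rcases c with l | l
  · exact length_spell_le b l
  · change (ofFreeGroupBasis b).wordLength (.inr (ConjClasses.mk (spell b l))) ≤ _
    rw [wordLength_inr_mk]
    exact (cycLength_le _ _).trans (length_spell_le b l)

theorem exists_list_short {N : ℕ} {S : List (FWord F)}
    (h : ∀ r ∈ S, (ofFreeGroupBasis b).wordLength r ≤ N) :
    ∃ T : List (WordCode n), (∀ c ∈ T, Short N c) ∧ T.map (decode b) = S := by
  induction S with
  | nil => exact ⟨[], by simp, rfl⟩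
  | cons r S ih =>
    simp only [List.forall_mem_cons] at h
    obtain ⟨T, hT, hS⟩ := ih h.2
    obtain ⟨c, hc, hr⟩ := exists_short_of_wordLength_le b h.1
    exact ⟨c :: T, List.forall_mem_cons.2 ⟨hc, hT⟩, by simp [hr, hS]⟩

/-! ### The automorphisms relating neighbouring bases -/

/-- The automorphisms carrying the given basis to a neighbour, and their inverses. -/
def neighbourAuts : Set (F ≃* F) :=
  {e | (ofFreeGroupBasis b).IsNeighbour ((ofFreeGroupBasis b).map e)} ∪
    {e | (ofFreeGroupBasis b).IsNeighbour ((ofFreeGroupBasis b).map e.symm)}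

theorem finite_neighbourAuts [Group.FG F] : (neighbourAuts b).Finite := by
  have h := (ofFreeGroupBasis b).finite_setOf_isNeighbour_map
  refine h.union (h.preimage (f := MulEquiv.symm) ?_)
  exact fun e _ e' _ h => by simpa using congrArg MulEquiv.symm h

theorem mem_neighbourAuts_of_map_eq {e : F ≃* F}
    (h : (ofFreeGroupBasis b).map e = ofFreeGroupBasis b) : e ∈ neighbourAuts b :=
  .inl (by rw [Set.mem_ofPred_eq, h]; exact .inl rfl)

/-- The pair of bases is translated back so that one of them is the given basis. Edges are
unordered, which is why `neighbourAuts` also contains inverses. -/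
theorem mem_neighbourAuts_of_adj {ψ ψ' : F ≃* F}
    (h : (GammaF F).Adj ((ofFreeGroupBasis b).map ψ) ((ofFreeGroupBasis b).map ψ')) :
    ψ.trans ψ'.symm ∈ neighbourAuts b := by
  rw [GammaF, SimpleGraph.fromRel_adj] at h
  rcases h.2 with h | h
  · right
    have := h.map ψ.symm
    rw [map_map_symm, ← map_trans] at this
    exact this
  · left
    have := h.map ψ'.symm
    rw [map_map_symm, ← map_trans] at this
    exact this

/-- All bases have the same finite cardinality, and a bijection between bases extends to an
automorphism. -/
theorem exists_map_eq (Z : FBasis F) : ∃ ψ : F ≃* F, (ofFreeGroupBasis b).map ψ = Z := by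
  let σ : Fin n ≃ Z.1 := Equiv.ofFreeGroupEquiv (b.repr.symm.trans Z.equiv.symm)
  let ψ : F ≃* F := (b.repr.trans (FreeGroup.freeGroupCongr σ)).trans Z.equiv
  have hψ : ∀ i, ψ (b i) = σ i := by
    intro i
    simp [ψ]
  refine ⟨ψ, Subtype.ext ?_⟩
  ext z
  constructor
  · rintro ⟨_, ⟨i, rfl⟩, rfl⟩
    rw [hψ]
    exact (σ i).2
  · intro hz
    exact ⟨b (σ.symm ⟨z, hz⟩), ⟨_, rfl⟩, by rw [hψ, Equiv.apply_symm_apply]⟩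

/-- The total length of a sequence of codes. -/
def totalLength (S : List (WordCode n)) : ℕ := (S.flatMap letters).length

/-- The `X`-length of a word is the length of its image under `e` in the given basis. Repeated words
are counted once on the left, and codes need not be reduced, hence only an inequality. -/
theorem height_le_totalLength [DecidableEq (FWord F)] (X : FBasis F) (e : F ≃* F)
    (S S' : List (WordCode n))
    (hX : X.map e = ofFreeGroupBasis b)
    (h : S.map (fun c => FWord.map e (decode b c)) = S'.map (decode b)) :
    X.height (S.map (decode b)).toFinset ≤ totalLength S' := by
  have key : ∀ L : List (FWord F), X.height L.toFinset ≤ (L.map X.wordLength).sum := by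
    intro L
    induction L with
    | nil => simp [height]
    | cons r L ih =>
      rw [List.toFinset_cons, List.map_cons, List.sum_cons]
      by_cases hr : r ∈ L.toFinset
      · rw [Finset.insert_eq_of_mem hr]
        omega
      · rw [height, Finset.sum_insert hr]
        rw [height] at ih
        omega
  refine (key _).trans ?_
  have h1 : (S.map (decode b)).map X.wordLength =
      S'.map fun c => (ofFreeGroupBasis b).wordLength (decode b c) := by
    have := congrArg (List.map (ofFreeGroupBasis b).wordLength) h
    rw [List.map_map, List.map_map, ← hX] at this
    rw [List.map_map, ← hX]
    refine Eq.trans (List.map_congr_left fun c _ => ?_) this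
    exact (X.wordLength_map e _).symm
  rw [h1, totalLength, List.length_flatMap]
  exact List.sum_le_sum fun c _ => wordLength_decode_le b c

/-- Sequences of words in the same orbit are joined by moves through short codes. -/
theorem reflTransGen_move_of_carriesSeq [Group.FG F] {C : ℕ} (hC1 : 1 ≤ C)
    (hC : ∀ e ∈ neighbourAuts b, ∀ c : WordCode n,
      (letters (act b e c)).length ≤ C * (letters c).length)
    {S₁ S₂ : List (WordCode n)} {φ : F ≃* F} (hφ : CarriesSeq b φ S₁ S₂) {N : ℕ}
    (h1 : totalLength S₁ ≤ N) (h2 : totalLength S₂ ≤ N) :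
    Relation.ReflTransGen (Move b (neighbourAuts b) (C * N)) (S₁.map reduced)
      (S₂.map reduced) := by
  classical
  set E := ofFreeGroupBasis b with hE
  set R : Finset (FWord F) := (S₁.map (decode b)).toFinset with hR
  have hNC : N ≤ C * N := Nat.le_mul_of_pos_left N hC1
  have hlen : ∀ S : List (WordCode n), totalLength S ≤ N → ∀ c ∈ S.map reduced, Short N c := by
    intro S hS d hd
    obtain ⟨c, hc, rfl⟩ := List.mem_map.1 hd
    refine short_reduced (le_trans ?_ hS)
    rw [totalLength, List.length_flatMap]
    exact List.single_le_sum (by simp) _ (List.mem_map.2 ⟨c, hc, rfl⟩)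
  have hrefl : MulEquiv.refl F ∈ neighbourAuts b :=
    mem_neighbourAuts_of_map_eq b (map_refl _)
  have hdec : ∀ S : List (WordCode n), (S.map reduced).map (decode b) = S.map (decode b) := by
    intro S
    rw [List.map_map]
    exact List.map_congr_left fun c _ => decode_reduced b c
  -- one step along the path of bases
  have trans : ∀ (T T' : List (WordCode n)) (e : F ≃* F), (∀ c ∈ T, Short N c) →
      (∀ c ∈ T', Short (C * N) c) → e ∈ neighbourAuts b →
      T'.map (decode b) = T.map (fun c => FWord.map e (decode b c)) →
      Relation.ReflTransGen (Move b (neighbourAuts b) (C * N)) T T' := by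
    intro T T' e hT hT' he h
    have hact : ∀ c ∈ T.map (act b e), Short (C * N) c := by
      intro d hd
      obtain ⟨c, hc, rfl⟩ := List.mem_map.1 hd
      exact ⟨reduced_of_mem_choices (act_mem_choices b e c),
        (hC e he c).trans (Nat.mul_le_mul_left C (hT c hc).2)⟩
    -- Applying `e` may lengthen the codes up to `C * N`; conjugations by letters then correct the
    -- representatives of cyclic words.
    refine .head (b := T.map (act b e)) ⟨fun c hc => (hT c hc).mono hNC, hact, e, he, ?_⟩ ?_
    · rw [List.forall₂_map_left_iff, List.forall₂_same]
      exact fun c _ => act_mem_choices b e c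
    · refine Relation.ReflTransGen.mono
        (fun _ _ h => Move.mono b (Set.singleton_subset_iff.2 hrefl) h) _ _
        (reflTransGen_move_of_decode_eq b hact hT' ?_)
      rw [h, List.map_map]
      exact List.map_congr_left fun c _ => decode_of_mem_choices (act_mem_choices b e c)
  have hφ' : (E.map φ.symm).map φ = E := map_symm_map _ _
  have hEN : E.height R ≤ N :=
    (height_le_totalLength b E (MulEquiv.refl F) S₁ S₁ (map_refl _) (by
      refine List.map_congr_left fun c _ => ?_
      have := FWord.map_symm_map (MulEquiv.refl F) (decode b c)
      rcases c with l | l <;> rfl)).trans h1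
  have hφN : (E.map φ.symm).height R ≤ N :=
    (height_le_totalLength b (E.map φ.symm) φ S₁ S₂ hφ' hφ).trans h2
  have hreach := reachable_induce_height R N ⟨E, hEN⟩ ⟨E.map φ.symm, hφN⟩
  rw [SimpleGraph.reachable_iff_reflTransGen] at hreach
  -- At a basis `E.map ψ` on the path, the words `ψ⁻¹(S₁)` have the same lengths in `E` as `S₁` has
  -- in `E.map ψ`, hence at most `N`. Consecutive sequences differ by an automorphism in
  -- `neighbourAuts b`.
  have key : ∀ Z : {X : FBasis F | X.height R ≤ N},
      Relation.ReflTransGen ((GammaF F).induce {X : FBasis F | X.height R ≤ N}).Adj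
        ⟨E, hEN⟩ Z → ∀ ψ : F ≃* F, E.map ψ = Z.1 → ∀ T' : List (WordCode n),
      (∀ c ∈ T', Short (C * N) c) →
      T'.map (decode b) = S₁.map (fun c => FWord.map ψ.symm (decode b c)) →
      Relation.ReflTransGen (Move b (neighbourAuts b) (C * N)) (S₁.map reduced) T' := by
    intro Z hZ
    induction hZ with
    | refl =>
      intro ψ hψ T' hT' h
      refine trans _ T' ψ.symm (hlen S₁ h1) hT' ?_ ?_
      · refine mem_neighbourAuts_of_map_eq b ?_
        conv_lhs => rw [← hE, ← show E.map ψ = E from hψ]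
        exact map_map_symm _ _
      · rw [h, List.map_map]
        exact List.map_congr_left fun c _ => by simp [decode_reduced]
    | @tail Z Z' _ hadj ih =>
      intro ψ' hψ' T' hT' h
      obtain ⟨ψ, hψ⟩ := exists_map_eq b Z.1
      obtain ⟨T, hT, hTS⟩ := exists_list_short b (N := N)
        (S := S₁.map fun c => FWord.map ψ.symm (decode b c)) (by
          intro r hr
          obtain ⟨c, hc, rfl⟩ := List.mem_map.1 hr
          rw [← wordLength_map _ ψ, hψ]
          have h3 := FWord.map_symm_map ψ.symm (decode b c)
          rw [MulEquiv.symm_symm] at h3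
          rw [h3]
          refine le_trans ?_ Z.2
          exact Finset.single_le_sum (f := fun r => Z.1.wordLength r) (fun _ _ => Nat.zero_le _)
            (by rw [hR]; exact List.mem_toFinset.2 (List.mem_map.2 ⟨c, hc, rfl⟩)))
      refine (ih ψ hψ T (fun c hc => (hT c hc).mono hNC) hTS).trans ?_
      refine trans T T' (ψ.trans ψ'.symm) hT hT' ?_ ?_
      · apply mem_neighbourAuts_of_adj
        rw [hψ, ← hE, hψ']
        exact hadj
      · have h4 := congrArg (List.map (FWord.map (ψ.trans ψ'.symm))) hTS
        rw [List.map_map, List.map_map] at h4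
        rw [h]
        refine Eq.trans (List.map_congr_left fun c _ => ?_) h4.symm
        simp only [Function.comp_apply, FWord.map_trans]
        have h3 := FWord.map_symm_map ψ.symm (decode b c)
        rw [MulEquiv.symm_symm] at h3
        rw [h3]
  refine key _ hreach φ.symm rfl _ (fun c hc => (hlen S₂ h2 c hc).mono hNC) ?_
  rw [hdec, ← hφ]
  rfl

/-! ### Counting short codes -/

/-- A short code is recorded by its kind and by `M` entries, each one of `2 * n` letters or `none`
as padding. -/
theorem ncard_short_le (k M : ℕ) :
    {T : List (WordCode n) | T.length = k ∧ ∀ c ∈ T, Short M c}.Finite ∧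
    {T : List (WordCode n) | T.length = k ∧ ∀ c ∈ T, Short M c}.ncard ≤
      (2 * (2 * n + 1) ^ M) ^ k := by
  let f : List (WordCode n) → (Fin k → Bool × (Fin M → Option (Fin n × Bool))) := fun T i =>
    ((T.getD i (.inl [])).isLeft, fun j => (letters (T.getD i (.inl [])))[(j : ℕ)]?)
  have hinj : Set.InjOn f {T : List (WordCode n) | T.length = k ∧ ∀ c ∈ T, Short M c} := by
    rintro T ⟨hT, hT'⟩ U ⟨hU, hU'⟩ h
    refine List.ext_getElem (hT.trans hU.symm) fun i hi hi' => ?_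
    have h1 := congrFun h ⟨i, hT ▸ hi⟩
    simp only [f, Prod.mk.injEq, List.getD_eq_getElem _ _ hi, List.getD_eq_getElem _ _ hi'] at h1
    have h2 := hT' _ (List.getElem_mem hi)
    have h3 := hU' _ (List.getElem_mem hi')
    generalize T[i] = c at h1 h2
    generalize U[i] = c' at h1 h3
    have h4 : letters c = letters c' := by
      refine List.ext_getElem? fun j => ?_
      by_cases hj : j < M
      · exact congrFun h1.2 ⟨j, hj⟩
      · rw [List.getElem?_eq_none (h2.2.trans (not_lt.1 hj)),
          List.getElem?_eq_none (h3.2.trans (not_lt.1 hj))]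
    rcases c with l | l <;> rcases c' with l' | l'
    · exact congrArg Sum.inl h4
    · simp at h1
    · simp at h1
    · exact congrArg Sum.inr h4
  have hfin := Set.Finite.of_finite_image (Set.toFinite _) hinj
  refine ⟨hfin, ?_⟩
  rw [← hinj.ncard_image]
  refine (Set.ncard_le_ncard (Set.subset_univ _)).trans_eq ?_
  rw [Set.ncard_univ, Nat.card_eq_fintype_card]
  simp only [Fintype.card_fun, Fintype.card_prod, Fintype.card_bool, Fintype.card_option,
    Fintype.card_fin]
  rw [mul_comm n 2]

end WordCode

/-! ### The algorithm -/

namespace WordCode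

variable {F : Type*} [Group F] {n : ℕ} (b : FreeGroupBasis (Fin n) F)

/-- The sequences obtained from a sequence of codes by one of the given automorphisms. -/
noncomputable def step (W : List (F ≃* F)) (T : List (WordCode n)) : List (List (WordCode n)) :=
  (W.map fun e => (T.map (choices b e)).sections).flatten

/-- The sequences obtained in the given number of steps. -/
noncomputable def search (W : List (F ≃* F)) (T : List (WordCode n)) (k : ℕ) :
    List (List (WordCode n)) :=
  (fun L => L.flatMap (step b W))^[k] [T]

/-- The codes of the basis elements. -/
def basisCodes (n : ℕ) : List (WordCode n) := List.ofFn fun i => .inl [(i, true)]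

/-- Searching for an automorphism. -/
noncomputable def solve (W : List (F ≃* F)) (C : ℕ)
    (p : List (WordCode n) × List (WordCode n)) : Option (Fin n → List (Fin n × Bool)) :=
  -- The basis travels behind `S₁`, so its images under the automorphism found can be read off. The
  -- number of steps is the bound of `ncard_short_le`.
  (((search b W (p.1.map reduced ++ basisCodes n)
    ((2 * (2 * n + 1) ^ (C * (totalLength p.1 + totalLength p.2))) ^ p.1.length)).flatMap
      fun S => if S.take p.1.length = p.2.map reduced then [S] else []).head?).map
        fun S i => letters ((S.drop p.1.length).getD i (.inl []))

variable {b}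

theorem mem_step {W : List (F ≃* F)} {T T' : List (WordCode n)} :
    T' ∈ step b W T ↔ ∃ e ∈ W, List.Forall₂ (fun c' c => c' ∈ choices b e c) T' T := by
  simp only [step, List.mem_flatten, List.mem_map, exists_exists_and_eq_and, List.mem_sections,
    List.forall₂_map_right_iff]

theorem mem_search_succ {W : List (F ≃* F)} {T T' : List (WordCode n)} {k : ℕ} :
    T' ∈ search b W T (k + 1) ↔ ∃ U ∈ search b W T k, T' ∈ step b W U := by
  rw [search, Function.iterate_succ_apply', List.mem_flatMap]
  rfl

theorem exists_map_eq_of_mem_search {W : List (F ≃* F)} {T T' : List (WordCode n)} {k : ℕ}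
    (h : T' ∈ search b W T k) :
    ∃ φ : F ≃* F, T'.map (decode b) = T.map fun c => FWord.map φ (decode b c) := by
  induction k generalizing T' with
  | zero =>
    obtain rfl := List.mem_singleton.1 h
    refine ⟨MulEquiv.refl F, List.map_congr_left fun c _ => ?_⟩
    have := FWord.map_symm_map (MulEquiv.refl F) (decode b c)
    rcases c with l | l <;> rfl
  | succ k ih =>
    obtain ⟨U, hU, hT'⟩ := mem_search_succ.1 h
    obtain ⟨φ, hφ⟩ := ih hU
    obtain ⟨e, -, he⟩ := mem_step.1 hT'
    refine ⟨φ.trans e, ?_⟩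
    have h1 : T'.map (decode b) = U.map fun c => FWord.map e (decode b c) := by
      rw [← List.forall₂_eq_eq_eq, List.forall₂_map_left_iff, List.forall₂_map_right_iff]
      exact he.imp fun _ _ => decode_of_mem_choices
    have h2 := congrArg (List.map (FWord.map e)) hφ
    rw [List.map_map, List.map_map] at h2
    rw [h1]
    refine h2.trans (List.map_congr_left fun c _ => ?_)
    rw [FWord.map_trans]
    rfl

/-- The tail can always follow the head, since the search imposes no length bound and `act` is an
admissible choice for every automorphism. -/
theorem exists_append_mem_search {W : List (F ≃* F)}
    {r : List (WordCode n) → List (WordCode n) → Prop}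
    (hr : ∀ T T', r T T' → T' ∈ step b W T) {T T' : List (WordCode n)} {k : ℕ}
    (h : T' ∈ reachIn r T k) (U : List (WordCode n)) :
    ∃ U', T' ++ U' ∈ search b W (T ++ U) k := by
  induction k generalizing T' with
  | zero =>
    obtain rfl : T' = T := h
    exact ⟨U, List.mem_singleton_self _⟩
  | succ k ih =>
    obtain ⟨V, hV, hT'⟩ := h
    obtain ⟨V', hV'⟩ := ih hV
    obtain ⟨e, he, h1⟩ := mem_step.1 (hr _ _ hT')
    refine ⟨V'.map (act b e), mem_search_succ.2 ⟨_, hV', mem_step.2 ⟨e, he, ?_⟩⟩⟩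
    refine List.rel_append h1 ?_
    rw [List.forall₂_map_left_iff, List.forall₂_same]
    exact fun c _ => act_mem_choices b e c

theorem spell_letters_of_decode_eq {c : WordCode n} {g : F} (h : decode b c = .inl g) :
    spell b (letters c) = g := by
  rcases c with l | l
  · exact Sum.inl.inj h
  · cases h

theorem carriesSeq_of_solve_eq_some {W : List (F ≃* F)} {C : ℕ} {S₁ S₂ : List (WordCode n)}
    {w : Fin n → List (Fin n × Bool)} (h : solve b W C (S₁, S₂) = some w) :
    ∃ φ : F ≃* F, (∀ i, φ (b i) = spell b (w i)) ∧ CarriesSeq b φ S₁ S₂ := by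
  obtain ⟨S, hS, rfl⟩ := Option.map_eq_some_iff.1 h
  obtain ⟨T, hT, hST⟩ := List.mem_flatMap.1 (List.mem_of_head? hS)
  split_ifs at hST with hk
  · obtain rfl := List.mem_singleton.1 hST
    obtain ⟨φ, hφ⟩ := exists_map_eq_of_mem_search hT
    rw [List.map_append] at hφ
    refine ⟨φ, fun i => ?_, ?_⟩
    · have h1 := congrArg (List.drop S₁.length) hφ
      rw [List.drop_left' (by simp), ← List.map_drop] at h1
      have h2 := congrArg (fun L => L[(i : ℕ)]?) h1
      simp only [List.getElem?_map, basisCodes, List.getElem?_ofFn, i.2, dif_pos,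
        Option.map_some] at h2
      obtain ⟨c, hc, hc'⟩ := Option.map_eq_some_iff.1 h2
      simp only [List.getD_eq_getElem?_getD, hc, Option.getD_some]
      exact (spell_letters_of_decode_eq hc').symm
    · have h1 := congrArg (List.take S₁.length) hφ
      rw [List.take_left' (by simp), ← List.map_take, hk, List.map_map, List.map_map] at h1
      refine Eq.trans (List.map_congr_left fun c _ => ?_)
        (h1.symm.trans (List.map_congr_left fun c _ => ?_))
      · simp [decode_reduced]
      · simp [decode_reduced]
  · simp at hST

/-- The joining moves stay in a finite set of short sequences. A shortest chain padded with identity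
moves therefore uses exactly the number of steps searched. -/
theorem solve_ne_none [Group.FG F] {W : List (F ≃* F)} {C : ℕ}
    (hW : ∀ e, e ∈ W ↔ e ∈ neighbourAuts b) (hC1 : 1 ≤ C)
    (hC : ∀ e ∈ neighbourAuts b, ∀ c : WordCode n,
      (letters (act b e c)).length ≤ C * (letters c).length)
    {S₁ S₂ : List (WordCode n)} {φ : F ≃* F} (hφ : CarriesSeq b φ S₁ S₂) :
    solve b W C (S₁, S₂) ≠ none := by
  set N := totalLength S₁ + totalLength S₂ with hN
  have hmove := reflTransGen_move_of_carriesSeq b hC1 hC hφ (N := N) (by omega) (by omega)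
  have hstep : ∀ T T', Move b (neighbourAuts b) (C * N) T T' → T' ∈ step b W T := by
    rintro T T' ⟨-, -, e, he, h⟩
    exact mem_step.2 ⟨e, (hW e).2 he, h⟩
  have hlen : ∀ T T', Move b (neighbourAuts b) (C * N) T T' → T'.length = T.length := by
    rintro T T' ⟨-, -, e, he, h⟩
    exact h.length_eq
  obtain ⟨hfin, hcard⟩ := ncard_short_le (n := n) S₁.length (C * N)
  set Q := {T : List (WordCode n) | T.length = S₁.length ∧ ∀ c ∈ T, Short (C * N) c} with hQ
  -- Fixing the length of the source confines the targets to the finite set `Q`.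
  let r : List (WordCode n) → List (WordCode n) → Prop :=
    fun T T' => Move b (neighbourAuts b) (C * N) T T' ∧ T.length = S₁.length
  have hr : ∀ T, Relation.ReflTransGen (Move b (neighbourAuts b) (C * N)) (S₁.map reduced) T →
      Relation.ReflTransGen r (S₁.map reduced) T ∧ T.length = S₁.length := by
    intro T hT
    induction hT with
    | refl => exact ⟨.refl, by simp⟩
    | tail _ h ih => exact ⟨ih.1.tail ⟨h, ih.2⟩, (hlen _ _ h).trans ih.2⟩
  obtain ⟨hr, hlen₂⟩ := hr _ hmove
  have hrefl : MulEquiv.refl F ∈ neighbourAuts b :=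
    mem_neighbourAuts_of_map_eq b (FBasis.map_refl _)
  have hreach : S₂.map reduced ∈ reachIn r (S₁.map reduced)
      ((2 * (2 * n + 1) ^ (C * N)) ^ S₁.length) := by
    refine mem_reachIn_of_reflTransGen hfin ?_ ?_ ?_ hr hcard
    · rintro T ⟨h1, h2⟩
      exact ⟨⟨h2, h2, _, hrefl, forall₂_choices_refl b h2⟩, h1⟩
    · rintro T T' ⟨h1, h2⟩
      exact ⟨(hlen _ _ h1).trans h2, h1.2.1⟩
    · refine ⟨by simp, fun d hd => ?_⟩
      obtain ⟨c, hc, rfl⟩ := List.mem_map.1 hd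
      refine short_reduced (le_trans ?_ (Nat.le_mul_of_pos_left N hC1))
      refine le_trans ?_ (Nat.le_add_right (totalLength S₁) (totalLength S₂))
      rw [totalLength, List.length_flatMap]
      exact List.single_le_sum (by simp) _ (List.mem_map.2 ⟨c, hc, rfl⟩)
  obtain ⟨U, hU⟩ := exists_append_mem_search (fun T T' h => hstep T T' h.1) hreach (basisCodes n)
  rw [solve, Ne, Option.map_eq_none_iff, List.head?_eq_none_iff]
  refine List.ne_nil_of_mem (a := S₂.map reduced ++ U) (List.mem_flatMap.2 ⟨_, hU, ?_⟩)
  rw [if_pos (List.take_left' hlen₂)]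
  exact List.mem_singleton_self _

/-! ### Computability -/

theorem primrec_reduce {α : Type*} [Primcodable α] [DecidableEq α] :
    Primrec (FreeGroup.reduce : List (α × Bool) → List (α × Bool)) := by
  have h : Primrec fun L : List (α × Bool) => L.foldr (fun x (M : List (α × Bool)) =>
      (List.casesOn M [x] fun y M' =>
        if x = (y.1, !y.2) then M' else x :: y :: M' : List (α × Bool))) [] := by
    refine Primrec.list_foldr (h := fun _ (p : (α × Bool) × List (α × Bool)) =>
      (List.casesOn p.2 [p.1] fun y M' =>
        if p.1 = (y.1, !y.2) then M' else p.1 :: y :: M' : List (α × Bool)))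
      Primrec.id (Primrec.const []) ?_
    refine Primrec.list_casesOn (f := fun q : List (α × Bool) × (α × Bool) × List (α × Bool) =>
      q.2.2) (g := fun q => [q.2.1]) (h := fun q p => if q.2.1 = (p.1.1, !p.1.2) then p.2 else
        q.2.1 :: p.1 :: p.2) (Primrec.snd.comp Primrec.snd) ?_ ?_
    · exact Primrec.list_cons.comp (Primrec.fst.comp Primrec.snd) (Primrec.const [])
    · have hx : Primrec fun q : (List (α × Bool) × (α × Bool) × List (α × Bool)) ×
          (α × Bool) × List (α × Bool) => q.1.2.1 :=
        Primrec.fst.comp (Primrec.snd.comp Primrec.fst)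
      have hy : Primrec fun q : (List (α × Bool) × (α × Bool) × List (α × Bool)) ×
          (α × Bool) × List (α × Bool) => q.2.1 := Primrec.fst.comp Primrec.snd
      have hM : Primrec fun q : (List (α × Bool) × (α × Bool) × List (α × Bool)) ×
          (α × Bool) × List (α × Bool) => q.2.2 := Primrec.snd.comp Primrec.snd
      refine Primrec.ite ?_ hM (Primrec.list_cons.comp hx (Primrec.list_cons.comp hy hM))
      exact Primrec.eq.comp hx (Primrec.pair (Primrec.fst.comp hy)
        (Primrec.not.comp (Primrec.snd.comp hy)))
  refine h.of_eq fun L => ?_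
  induction L with
  | nil => rfl
  | cons x L ih =>
    rw [List.foldr_cons, ih, FreeGroup.reduce.cons]
    congr 1
    ext y M : 2
    simp only [Prod.ext_iff]

/-- `L` is a constant list of an uncoded type, such as automorphisms, so it is unrolled rather than
treated as input. -/
theorem primrec_map_list {ι α σ : Type*} [Primcodable α] [Primcodable σ] (L : List ι)
    {f : ι → α → σ} (h : ∀ i, Primrec (f i)) : Primrec fun a => L.map fun i => f i a := by
  induction L with
  | nil => exact Primrec.const []
  | cons i L ih => exact Primrec.list_cons.comp (h i) ih

theorem primrec_sections {α : Type*} [Primcodable α] :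
    Primrec (List.sections : List (List α) → List (List α)) := by
  have h : Primrec fun L : List (List α) =>
      L.foldr (fun l M => M.flatMap fun s => l.map fun a => a :: s) [[]] := by
    refine Primrec.list_foldr (h := fun _ (p : List α × List (List α)) =>
      p.2.flatMap fun s => p.1.map fun a => a :: s)
      Primrec.id (Primrec.const [[]]) ?_
    refine Primrec.list_flatMap (Primrec.snd.comp Primrec.snd) ?_
    refine Primrec.list_map (Primrec.fst.comp (Primrec.snd.comp Primrec.fst)) ?_
    exact Primrec.list_cons.comp Primrec.snd (Primrec.snd.comp Primrec.fst)
  refine h.of_eq fun L => ?_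
  induction L with
  | nil => rfl
  | cons l L ih => rw [List.foldr_cons, ih]; rfl

theorem primrec_letters : Primrec (letters : WordCode n → List (Fin n × Bool)) := by
  refine (Primrec.sumCasesOn (f := fun c : WordCode n => c) (g := fun _ l => l)
    (h := fun _ l => l) Primrec.id Primrec.snd Primrec.snd).of_eq fun c => ?_
  rcases c with l | l <;> rfl

theorem primrec_reduced : Primrec (reduced : WordCode n → WordCode n) := by
  refine (Primrec.sumCasesOn (f := fun c : WordCode n => c)
    (g := fun _ l => (.inl (FreeGroup.reduce l) : WordCode n))
    (h := fun _ l => .inr (FreeGroup.reduce l)) Primrec.id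
    (Primrec.sumInl.comp (primrec_reduce.comp Primrec.snd))
    (Primrec.sumInr.comp (primrec_reduce.comp Primrec.snd))).of_eq fun c => ?_
  rcases c with l | l <;> rfl

theorem primrec_totalLength : Primrec (totalLength : List (WordCode n) → ℕ) :=
  Primrec.list_length.comp (Primrec.list_flatMap Primrec.id (primrec_letters.comp Primrec.snd))

variable (b)

/-- `e` enters only through a finite table, its values on letters; what remains is substitution and
free reduction. -/
theorem primrec_code_map_spell (e : F ≃* F) : Primrec fun l => code b (e (spell b l)) := by
  have h : Primrec fun l : List (Fin n × Bool) =>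
      FreeGroup.reduce (l.flatMap fun x => code b (e (spell b [x]))) :=
    primrec_reduce.comp (Primrec.list_flatMap Primrec.id
      ((Primrec.dom_finite fun x => code b (e (spell b [x]))).comp Primrec.snd))
  exact h.of_eq fun l => by rw [map_spell, code_spell]

theorem primrec_choices (e : F ≃* F) : Primrec (choices b e) := by
  have h1 : Primrec fun l : List (Fin n × Bool) =>
      (conjugators b).map fun g => (.inr (code b (g * e (spell b l) * g⁻¹)) : WordCode n) :=
    primrec_map_list _ fun g =>
      Primrec.sumInr.comp (primrec_code_map_spell b (e.trans (MulAut.conj g)))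
  have h2 : Primrec fun l : List (Fin n × Bool) =>
      [(.inl (code b (e (spell b l))) : WordCode n)] :=
    Primrec.list_cons.comp (Primrec.sumInl.comp (primrec_code_map_spell b e)) (Primrec.const [])
  refine (Primrec.sumCasesOn (f := fun c : WordCode n => c)
    (g := fun _ l => [(.inl (code b (e (spell b l))) : WordCode n)])
    (h := fun _ l => (conjugators b).map fun g => .inr (code b (g * e (spell b l) * g⁻¹)))
    Primrec.id (h2.comp Primrec.snd) (h1.comp Primrec.snd)).of_eq fun c => ?_
  rcases c with l | l <;> rfl

theorem primrec_step (W : List (F ≃* F)) : Primrec (step b W) :=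
  Primrec.list_flatten.comp (primrec_map_list W fun e => primrec_sections.comp
    (Primrec.list_map Primrec.id ((primrec_choices b e).comp Primrec.snd)))

theorem primrec₂_search (W : List (F ≃* F)) : Primrec₂ (search b W) := by
  refine Primrec.nat_iterate (f := fun p : List (WordCode n) × ℕ => p.2) (g := fun p => [p.1])
    (h := fun _ L => L.flatMap (step b W)) Primrec.snd
    (Primrec.list_cons.comp Primrec.fst (Primrec.const [])) ?_
  exact Primrec.list_flatMap Primrec.snd ((primrec_step b W).comp Primrec.snd)

theorem primrec₂_pow : Primrec₂ ((· ^ ·) : ℕ → ℕ → ℕ) :=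
  Primrec₂.unpaired'.1 Nat.Primrec.pow

theorem primrec_solve (W : List (F ≃* F)) (C : ℕ) : Primrec (solve b W C) := by
  have hlen : Primrec fun p : List (WordCode n) × List (WordCode n) => p.1.length :=
    Primrec.list_length.comp Primrec.fst
  have hred : Primrec fun S : List (WordCode n) => S.map reduced :=
    Primrec.list_map Primrec.id (primrec_reduced.comp Primrec.snd)
  have hbound : Primrec fun p : List (WordCode n) × List (WordCode n) =>
      (2 * (2 * n + 1) ^ (C * (totalLength p.1 + totalLength p.2))) ^ p.1.length := by
    refine primrec₂_pow.comp (Primrec.nat_mul.comp (Primrec.const 2) (primrec₂_pow.comp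
      (Primrec.const (2 * n + 1)) (Primrec.nat_mul.comp (Primrec.const C) ?_))) hlen
    exact Primrec.nat_add.comp (primrec_totalLength.comp Primrec.fst)
      (primrec_totalLength.comp Primrec.snd)
  refine Primrec.option_map (Primrec.list_head?.comp (Primrec.list_flatMap
    ((primrec₂_search b W).comp (Primrec.list_append.comp (hred.comp Primrec.fst)
      (Primrec.const (basisCodes n))) hbound) ?_)) ?_
  · refine Primrec.ite ?_ (Primrec.list_cons.comp Primrec.snd (Primrec.const []))
      (Primrec.const [])
    exact Primrec.eq.comp (Primrec.list_take.comp (hlen.comp Primrec.fst) Primrec.snd)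
      (hred.comp (Primrec.snd.comp Primrec.fst))
  · refine Primrec.fin_curry.2 ?_
    have hdrop : Primrec fun q : ((List (WordCode n) × List (WordCode n)) × List (WordCode n)) ×
        Fin n => q.1.2.drop q.1.1.1.length :=
      Primrec.list_drop.comp (hlen.comp (Primrec.fst.comp Primrec.fst))
        (Primrec.snd.comp Primrec.fst)
    exact primrec_letters.comp ((Primrec.list_getD (Sum.inl [] : WordCode n)).comp hdrop
      (Primrec.fin_val.comp Primrec.snd))

theorem exists_computable_solves [Group.FG F] :
    ∃ f : List (WordCode n) × List (WordCode n) → Option (Fin n → List (Fin n × Bool)),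
      Computable f ∧ SolvesAutomorphismProblem b f := by
  -- `C` and `W` depend on `b` only, so they are constants of the algorithm and may be chosen
  -- non-constructively.
  obtain ⟨C, hC1, hC⟩ := exists_forall_length_act_le b _ (finite_neighbourAuts b)
  let W : List (F ≃* F) := (finite_neighbourAuts b).toFinset.toList
  have hW : ∀ e, e ∈ W ↔ e ∈ neighbourAuts b := by simp [W]
  refine ⟨solve b W C, (primrec_solve b W C).to_comp, fun S₁ S₂ =>
    ⟨fun w => carriesSeq_of_solve_eq_some, ?_⟩⟩
  rintro h ⟨φ, hφ⟩
  exact solve_ne_none hW hC1 hC hφ h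

end WordCode

theorem mainTheorem2 {F : Type*} [Group F] [IsFreeGroup F] [Group.FG F] :
    (∀ R : Finset (FWord F),
      -- `Γ(h)` is connected
      (GammaH R).Connected ∧
      -- `h` is constant on each connected subgraph of `Γ(h)`
      (∀ H : (GammaH R).Subgraph, H.Connected →
        ∀ X ∈ H.verts, ∀ Y ∈ H.verts, FBasis.height R X.1 = FBasis.height R Y.1) ∧
      -- every vertex of `Γ(F)` is joined to `Γ(h)` by a strictly `h`-decreasing path
      -- of Whitehead transforms
      (∀ X : FBasis F, ∃ Y : FBasis F, FBasis.IsLocalMin R Y ∧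
        ∃ p : (GammaF F).Walk X Y, p.support.IsChain (fun Z Z' =>
          FBasis.IsWhiteheadTransform Z Z' ∧ FBasis.height R Z' < FBasis.height R Z)) ∧
      -- every `h`-minimal basis is joined to every local minimum by an `h`-constant path
      -- in `Γ(h)`
      (∀ Y : FBasis F, FBasis.IsGlobalMin R Y →
        ∃ hY : FBasis.IsLocalMin R Y, ∀ X : {X : FBasis F // FBasis.IsLocalMin R X},
          ∃ p : (GammaH R).Walk ⟨Y, hY⟩ X,
            ∀ Z ∈ p.support, FBasis.height R Z.1 = FBasis.height R Y)) ∧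
    -- `Γ(F)` is connected
    (GammaF F).Connected ∧
    -- there is an algorithm deciding equivalence of finite sequences of words under
    -- automorphisms and producing an automorphism when there is one
    (∀ (n : ℕ) (b : FreeGroupBasis (Fin n) F),
      ∃ f : List (WordCode n) × List (WordCode n) → Option (Fin n → List (Fin n × Bool)),
        Computable f ∧ SolvesAutomorphismProblem b f) := by
  refine ⟨fun R => ⟨FBasis.connected_gammaH R, fun H _ X _ Y _ => X.2.height_eq Y.2,
    fun X => FBasis.exists_descent R X, fun Y hY => ⟨hY.isLocalMin, fun X => ?_⟩⟩,
    FBasis.connected_gammaF, fun n b => WordCode.exists_computable_solves b⟩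
  obtain ⟨p⟩ := (FBasis.connected_gammaH R).preconnected ⟨Y, hY.isLocalMin⟩ X
  exact ⟨p, fun Z _ => Z.2.height_eq hY.isLocalMin⟩
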